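/- Let $N=2k+R$ and consider a network of $N$ nodes, partitioned into $k$ source nodes $s_1,\dots,s_k$, $k$ destination nodes $d_1,\dots,d_k$ and $R$ relays, whose real inputs $U[t]\in\mathbb R^N$ and outputs $Y[t]\in\mathbb R^N$ satisfy $Y[t]=H\,U[t]+Z[t]$, $t=0,1,\dots$, with a fixed real $N\times N$ matrix $H$ and i.i.d. noise vectors $Z[t]$. Let $(X_1[t],\dots,X_k[t])$, $t=0,1,\dots$, be i.i.d. real random vectors, independent of the noise, with an arbitrary distribution of finite covariance. A coding scheme of block length $n\ge 1$ consists of measurable functions by which, at each time $t\in\{0,\dots,n-1\}$, the source node $s_m$ sends $U_{s_m}[t]=f_{s_m,t}\big((X_m[\tau])_{\tau<n},(Y_{s_m}[\tau])_{\tau<t}\big)$, every relay or destination node $i$ sends $U_i[t]=f_{i,t}\big((Y_i[\tau])_{\tau<t}\big)$, and, at the end of the block, the destination $d_m$ forms the estimate $\hat X_m=g_{d_m}\big((Y_{d_m}[\tau])_{\tau<n}\big)\in\mathbb R^n$. A tuple $(D_1,\dots,D_k)\in\mathbb R^k$ is achievable (under quadratic distortion) if for some $n\ge1$ there is a coding scheme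 of block length $n$ with $$\frac1n\,\mathbb E\Big[\sum_{t=0}^{n-1}\big(X_m[t]-\hat X_m[t]\big)^2\Big]\le D_m\qquad\text{for all } m\in\{1,\dots,k\}.$$ The distortion region is the closure of the set of achievable tuples in $\mathbb R^k$. Let $\mathbf K$ be an $N\times N$ matrix. Let $\mathcal D_G$ be the distortion region when $Z[t]$ is jointly Gaussian with covariance matrix $\mathbf K$, and let $\mathcal D_{NG}$ be the distortion region, for the same source and the same $H$, when $Z[t]$ has any other given distribution with covariance matrix $\mathbf K$. Then $$\mathcal D_G\subseteq\mathcal D_{NG}.$$ Equivalently, if $(D_1,\dots,D_k)$ is achievable with the Gaussian noise, then for every $\varepsilon>0$ the tuple $(D_1+\varepsilon,\dots,D_k+\varepsilon)$ is achievable with the other noise. -/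

import Mathlib

open MeasureTheory ProbabilityTheory

/-- `HasCovarianceMatrix μ K`: a random vector with law `μ` has finite second moments and
covariance matrix `K`. The mean is not restricted. -/
structure HasCovarianceMatrix {N : ℕ} (μ : Measure (Fin N → ℝ)) (K : Matrix (Fin N) (Fin N) ℝ) :
    Prop where
  memLp : ∀ i, MemLp (fun z : Fin N → ℝ => z i) 2 μ
  cov_eq : ∀ i j, covariance (fun z : Fin N → ℝ => z i) (fun z : Fin N → ℝ => z j) μ = K i j

/-- The roles of the `N` nodes of a `(k,N)` network: each node is exactly one of the sources
`s_1, …, s_k`, the destinations `d_1, …, d_k` and the relays `r_1, …, r_R` (so `N = 2 k + R`). -/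
structure NodeLayout (k R N : ℕ) where
  node : (Fin k ⊕ Fin k ⊕ Fin R) ≃ Fin N

namespace NodeLayout

variable {k R N : ℕ}

/-- The source node `s_m`. -/
def src (L : NodeLayout k R N) (m : Fin k) : Fin N := L.node (Sum.inl m)

/-- The destination node `d_m`. -/
def dst (L : NodeLayout k R N) (m : Fin k) : Fin N := L.node (Sum.inr (Sum.inl m))

/-- The relay node `r_p`. -/
def relay (L : NodeLayout k R N) (p : Fin R) : Fin N := L.node (Sum.inr (Sum.inr p))

end NodeLayout

/-- A coding scheme of block length `n` for `k` sources, `k` destinations and `R` relays.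
At time `t` a node knows its received signals at the times `0, …, t - 1`, and a source node knows
in addition its whole source block. All functions are measurable. -/
structure CodingScheme (k R n : ℕ) where
  /-- source encoding functions -/
  srcEnc : Fin k → (t : Fin n) → (Fin n → ℝ) → (Fin (t : ℕ) → ℝ) → ℝ
  /-- relay encoding functions -/
  relayEnc : Fin R → (t : Fin n) → (Fin (t : ℕ) → ℝ) → ℝ
  /-- destination encoding functions -/
  dstEnc : Fin k → (t : Fin n) → (Fin (t : ℕ) → ℝ) → ℝ
  /-- destination decoding functions -/
  dec : Fin k → (Fin n → ℝ) → (Fin n → ℝ)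
  measurable_srcEnc : ∀ (m : Fin k) (t : Fin n),
    Measurable (fun p : (Fin n → ℝ) × (Fin (t : ℕ) → ℝ) => srcEnc m t p.1 p.2)
  measurable_relayEnc : ∀ (p : Fin R) (t : Fin n), Measurable (relayEnc p t)
  measurable_dstEnc : ∀ (m : Fin k) (t : Fin n), Measurable (dstEnc m t)
  measurable_dec : ∀ m, Measurable (dec m)

namespace CodingScheme

variable {k R N n : ℕ}

/-- The signal sent at time `t` by node `i`, when the source blocks are `x` (symbol `x t m` of
source `m` at time `t`) and node `i` has received `y` at the times `0, …, t - 1`. -/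
def transmit (C : CodingScheme k R n) (L : NodeLayout k R N) (x : Fin n → Fin k → ℝ)
    (t : Fin n) (i : Fin N) (y : Fin (t : ℕ) → ℝ) : ℝ :=
  match L.node.symm i with
  | Sum.inl m => C.srcEnc m t (fun τ => x τ m) y
  | Sum.inr (Sum.inl m) => C.dstEnc m t y
  | Sum.inr (Sum.inr p) => C.relayEnc p t y

/-- The signal `Y_i[t]` received at time `t` by node `i` of the additive-noise network
`Y[t] = H U[t] + Z[t]`, when the source blocks are `x` and the noise is `z`. -/
noncomputable def received (C : CodingScheme k R n) (L : NodeLayout k R N)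
    (H : Matrix (Fin N) (Fin N) ℝ) (x : Fin n → Fin k → ℝ) (z : Fin n → Fin N → ℝ)
    (t : Fin n) (i : Fin N) : ℝ :=
  (∑ j, H i j * C.transmit L x t j
    (fun τ : Fin (t : ℕ) => C.received L H x z ⟨τ, τ.isLt.trans t.isLt⟩ j)) + z t i
termination_by (t : ℕ)
decreasing_by exact τ.isLt

/-- The estimate of the block of source `m` formed at the destination `d_m`. -/
noncomputable def estimate (C : CodingScheme k R n) (L : NodeLayout k R N)
    (H : Matrix (Fin N) (Fin N) ℝ) (x : Fin n → Fin k → ℝ) (z : Fin n → Fin N → ℝ)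
    (m : Fin k) : Fin n → ℝ :=
  C.dec m (fun t => C.received L H x z t (L.dst m))

/-- The sum over the block of the distortions of source `m`. -/
noncomputable def blockDistortion (φ : ℝ → ℝ → ℝ) (C : CodingScheme k R n)
    (L : NodeLayout k R N) (H : Matrix (Fin N) (Fin N) ℝ) (m : Fin k)
    (ω : (Fin n → Fin k → ℝ) × (Fin n → Fin N → ℝ)) : ℝ :=
  ∑ t, φ (ω.1 t m) (C.estimate L H ω.1 ω.2 m t)

end CodingScheme

/-- The joint law of `n` i.i.d. source vectors with law `P` and, independently of them,
`n` i.i.d. noise vectors with law `μ`. -/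
noncomputable def blockLaw {k N : ℕ} (P : Measure (Fin k → ℝ)) (μ : Measure (Fin N → ℝ))
    (n : ℕ) : Measure ((Fin n → Fin k → ℝ) × (Fin n → Fin N → ℝ)) :=
  (Measure.pi (fun _ : Fin n => P)).prod (Measure.pi (fun _ : Fin n => μ))

/-- The tuple `D` is `φ`-achievable over the network `Y = H U + Z` with noise law `μ`, for the
memoryless source with law `P`: some coding scheme of some block length `n ≥ 1` has, for each `m`,
a finite expected distortion per symbol that is at most `D m`. -/
def IsAchievable {k R N : ℕ} (φ : ℝ → ℝ → ℝ) (L : NodeLayout k R N)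
    (H : Matrix (Fin N) (Fin N) ℝ) (P : Measure (Fin k → ℝ)) (μ : Measure (Fin N → ℝ))
    (D : Fin k → ℝ) : Prop :=
  ∃ n : ℕ, 0 < n ∧ ∃ C : CodingScheme k R n, ∀ m : Fin k,
    Integrable (C.blockDistortion φ L H m) (blockLaw P μ n) ∧
      (1 / (n : ℝ)) * ∫ ω, C.blockDistortion φ L H m ω ∂(blockLaw P μ n) ≤ D m

/-- The `φ`-achievable distortion region: the closure of the set of achievable tuples. -/
def distortionRegion {k R N : ℕ} (φ : ℝ → ℝ → ℝ) (L : NodeLayout k R N)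
    (H : Matrix (Fin N) (Fin N) ℝ) (P : Measure (Fin k → ℝ)) (μ : Measure (Fin N → ℝ)) :
    Set (Fin k → ℝ) :=
  closure {D | IsAchievable φ L H P μ D}

/-- The quadratic distortion measure `ξ`. -/
def quadraticDistortion (x y : ℝ) : ℝ := (x - y) ^ 2

/-! The non-Gaussian network can be made to look Gaussian. Run `B` copies of a scheme in parallel
and spread each copy-time over a block of `B` channel uses: every node sends the symbols of its
copies mixed by an orthogonal matrix `Q` and undoes the mixing on what it receives. `H` acts on
nodes and `Q` on time slots, so the two commute, and copy `j` sees the original network with noise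
`∑ b, Q j b * Z[tB + b]` (`demix_received_interleave`). These sums are i.i.d. in `t` and have the
covariance of `Z`. If all entries of `Q` are `±1/√B` (`exists_flat_orthogonal`), the central limit
theorem makes their law nearly Gaussian (`tendsto_weightedSumLaw`). Noises of different copies need
not be independent, but the total distortion is the sum over the copies, so only the law of each
copy matters. Means are not prescribed; a deterministic offset added at each node corrects them.

Weak convergence of the noise law controls expectations of bounded continuous functions only, while
a scheme is merely measurable. So the scheme is first replaced, at small cost under the Gaussian
noise, by one with continuous encoders and bounded continuous decoders (`exists_continuous_scheme`).
Decoders come first; encoders follow from the last time back to the first, because a limit at time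
`T` reaches the decoders only through later encoders, which must already be continuous. Bounded
decoders give a dominating function that depends on the source alone. -/

/-! ### Continuous approximation of measurable functions -/

open Filter Topology in
/-- A measurable real function is an almost everywhere limit of continuous functions. -/
theorem exists_continuous_seq_tendsto_ae {E : Type*} [TopologicalSpace E] [NormalSpace E]
    [MeasurableSpace E] [BorelSpace E] (ρ : Measure E) [IsFiniteMeasure ρ] [ρ.WeaklyRegular]
    {f : E → ℝ} (hf : Measurable f) :
    ∃ g : ℕ → E → ℝ, (∀ l, Continuous (g l)) ∧
      ∀ᵐ x ∂ρ, Tendsto (fun l => g l x) atTop (𝓝 (f x)) := by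
  -- `f` need not be integrable; its truncations are, and bounded continuous functions are dense in
  -- `L¹`.
  let trunc : ℕ → E → ℝ := fun l x => max (-(l : ℝ)) (min (f x) l)
  have htm : ∀ l, Measurable (trunc l) := fun l =>
    measurable_const.max (hf.min measurable_const)
  have htb : ∀ l x, ‖trunc l x‖ ≤ l := fun l x => by
    rw [Real.norm_eq_abs, abs_le]
    exact ⟨le_max_left _ _, max_le (by simp) (min_le_right _ _)⟩
  have hti : ∀ l, MemLp (trunc l) 1 ρ := fun l =>
    MemLp.of_bound (htm l).aestronglyMeasurable l (Eventually.of_forall (htb l))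
  have hex : ∀ l : ℕ, ∃ g : BoundedContinuousFunction E ℝ,
      eLpNorm (trunc l - (g : E → ℝ)) 1 ρ ≤ ENNReal.ofReal (1 / ((l : ℝ) + 1)) ∧ MemLp g 1 ρ :=
    fun l => (hti l).exists_boundedContinuous_eLpNorm_sub_le ENNReal.one_ne_top
      (by simp only [ne_eq, ENNReal.ofReal_eq_zero, not_le]; positivity)
  choose g hg hgm using hex
  have hlim : Tendsto (fun l : ℕ => ENNReal.ofReal (1 / ((l : ℝ) + 1))) atTop (𝓝 0) := by
    simpa using ENNReal.tendsto_ofReal (tendsto_one_div_add_atTop_nhds_zero_nat (𝕜 := ℝ))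
  have hmeas : TendstoInMeasure ρ (fun l => trunc l - (g l : E → ℝ)) atTop (0 : E → ℝ) := by
    refine tendstoInMeasure_of_tendsto_eLpNorm one_ne_zero
      (fun l => ((hti l).sub (hgm l)).aestronglyMeasurable) aestronglyMeasurable_zero ?_
    refine tendsto_of_tendsto_of_tendsto_of_le_of_le tendsto_const_nhds hlim
      (fun _ => zero_le) (fun l => ?_)
    simpa using hg l
  obtain ⟨ns, hns, hae⟩ := hmeas.exists_seq_tendsto_ae
  refine ⟨fun l => g (ns l), fun l => (g (ns l)).continuous, ?_⟩
  filter_upwards [hae] with x hx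
  have htr : Tendsto (fun l => trunc (ns l) x) atTop (𝓝 (f x)) := by
    refine (tendsto_const_nhds (x := f x)).congr' ?_
    obtain ⟨M, hM⟩ := exists_nat_ge |f x|
    filter_upwards [hns.tendsto_atTop.eventually_ge_atTop M] with l hl
    have h1 : |f x| ≤ (ns l : ℝ) := hM.trans (by exact_mod_cast hl)
    rw [abs_le] at h1
    simp only [trunc]
    rw [min_eq_left h1.2, max_eq_right h1.1]
  have := htr.sub hx
  simpa using this

/-! ### Characteristic functions and the central limit theorem on the line -/

/-- Telescoping: factors of modulus at most 1 do not amplify errors. Thus `B` factors, each with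
error `o(1/B)`, give a product with error `o(1)`. -/
theorem norm_prod_sub_prod_le_sum {ι : Type*} (s : Finset ι) (a b : ι → ℂ)
    (ha : ∀ i, ‖a i‖ ≤ 1) (hb : ∀ i, ‖b i‖ ≤ 1) :
    ‖∏ i ∈ s, a i - ∏ i ∈ s, b i‖ ≤ ∑ i ∈ s, ‖a i - b i‖ := by
  classical
  induction s using Finset.induction_on with
  | empty => simp
  | insert i s hi ih =>
    rw [Finset.prod_insert hi, Finset.prod_insert hi, Finset.sum_insert hi]
    have h1 : ‖∏ j ∈ s, b j‖ ≤ 1 := by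
      rw [norm_prod]
      exact Finset.prod_le_one (fun _ _ => norm_nonneg _) (fun j _ => hb j)
    have h2 : a i * ∏ j ∈ s, a j - b i * ∏ j ∈ s, b j
        = a i * (∏ j ∈ s, a j - ∏ j ∈ s, b j) + (a i - b i) * ∏ j ∈ s, b j := by ring
    rw [h2]
    refine (norm_add_le _ _).trans ?_
    rw [norm_mul, norm_mul, add_comm]
    refine add_le_add ?_ ?_
    · exact mul_le_of_le_one_right (norm_nonneg _) h1
    · exact (mul_le_of_le_one_left (norm_nonneg _) (ha i)).trans ih

open Topology in
/-- Characteristic functions of laws with the same first two moments agree to second order. -/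
theorem charFun_sub_charFun_isLittleO (ρ ρ' : Measure ℝ) [IsProbabilityMeasure ρ]
    [IsProbabilityMeasure ρ'] (h : MemLp id 2 ρ) (h' : MemLp id 2 ρ')
    (h1 : ∫ x, x ∂ρ = ∫ x, x ∂ρ') (h2 : ∫ x, x ^ 2 ∂ρ = ∫ x, x ^ 2 ∂ρ') :
    (fun t => charFun ρ t - charFun ρ' t) =o[𝓝 0] fun t : ℝ => t ^ 2 := by
  have key : ∀ (σ : Measure ℝ) [IsProbabilityMeasure σ], MemLp id 2 σ →
      (fun t => charFun σ t - (1 + ((∫ x, x ∂σ : ℝ) : ℂ) * t * Complex.I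
        - ((∫ x, x ^ 2 ∂σ : ℝ) : ℂ) * t ^ 2 / 2)) =o[𝓝 0] fun t : ℝ => t ^ 2 := by
    intro σ _ hσ
    have hd : ContDiff ℝ ((2 : ℕ) : WithTop ℕ∞) (charFun σ) := contDiff_charFun hσ
    have ht := taylor_isLittleO_univ (x₀ := 0) hd
    have he : ∀ t, taylorWithinEval (charFun σ) 2 Set.univ 0 t
        = 1 + ((∫ x, x ∂σ : ℝ) : ℂ) * t * Complex.I
        - ((∫ x, x ^ 2 ∂σ : ℝ) : ℂ) * t ^ 2 / 2 := by
      intro t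
      have := taylorWithinEval_charFun_two_zero (P := σ) (X := id) aemeasurable_id
        (by simpa using hσ) t
      simpa using this
    simp only [sub_zero] at ht
    exact ht.congr_left fun t => by rw [he]
  have := (key ρ h).sub (key ρ' h')
  rw [h1, h2] at this
  simpa using this

open Filter Topology in
/-- Central limit theorem for the characteristic functions of equally weighted signed sums. -/
theorem tendsto_prod_charFun_signed (ρ : Measure ℝ) [IsProbabilityMeasure ρ]
    (h : MemLp id 2 ρ) (h1 : ∫ x, x ∂ρ = 0) {B : ℕ → ℕ} (hB : Tendsto B atTop atTop)
    (q : ∀ r, Fin (B r) → ℝ) (hq : ∀ r b, |q r b| = (√(B r))⁻¹) :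
    Tendsto (fun r => ∏ b, charFun ρ (q r b)) atTop
      (𝓝 (Complex.exp (-((∫ x, x ^ 2 ∂ρ : ℝ) : ℂ) / 2))) := by
  set v : ℝ := ∫ x, x ^ 2 ∂ρ with hv
  have hv0 : 0 ≤ v := integral_nonneg fun x => sq_nonneg x
  -- Comparison with the Gaussian of equal variance, whose product is exactly `exp (-v / 2)`, avoids
  -- complex logarithms.
  set ρ' : Measure ℝ := gaussianReal 0 v.toNNReal with hρ'
  have hm' : MemLp id 2 ρ' := memLp_id_gaussianReal 2
  have h1' : ∫ x, x ∂ρ' = 0 := integral_id_gaussianReal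
  have h2' : ∫ x, x ^ 2 ∂ρ' = v := by
    have := variance_id_gaussianReal (μ := 0) (v := v.toNNReal)
    rw [variance_eq_integral aemeasurable_id] at this
    simpa [← hρ', h1', Real.coe_toNNReal v hv0] using this
  have ho := charFun_sub_charFun_isLittleO ρ ρ' h hm' (by rw [h1, h1']) (by rw [h2'])
  have hs : Tendsto (fun r => (√(B r : ℝ))⁻¹) atTop (𝓝 0) :=
    tendsto_inv_atTop_zero.comp <| Real.tendsto_sqrt_atTop.comp <|
      tendsto_natCast_atTop_atTop.comp hB
  have ho' := (ho.comp_tendsto hs).norm_norm.tendsto_div_nhds_zero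
  -- Signs do not matter: a characteristic function at `-t` is the conjugate of its value at `t`.
  have hnorm : ∀ (r : ℕ) (b : Fin (B r)), ‖charFun ρ (q r b) - charFun ρ' (q r b)‖
      = ‖charFun ρ (√(B r))⁻¹ - charFun ρ' (√(B r))⁻¹‖ := by
    intro r b
    rcases abs_choice (q r b) with hc | hc
    · rw [← hq r b, hc]
    · rw [← hq r b, hc, charFun_neg, charFun_neg, ← map_sub, RCLike.norm_conj]
  have hg : ∀ᶠ r in atTop, ∏ b, charFun ρ' (q r b) = Complex.exp (-(v : ℂ) / 2) := by
    filter_upwards [hB.eventually_ge_atTop 1] with r hr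
    have hr0 : (B r : ℝ) ≠ 0 := by positivity
    have : ∀ b, charFun ρ' (q r b) = Complex.exp (-(v : ℂ) / 2 / B r) := by
      intro b
      rw [hρ', charFun_gaussianReal]
      have hsq : (q r b) ^ 2 = (B r : ℝ)⁻¹ := by
        rw [← sq_abs, hq, inv_pow, Real.sq_sqrt (Nat.cast_nonneg _)]
      have hsq' : ((q r b : ℝ) : ℂ) ^ 2 = ((B r : ℕ) : ℂ)⁻¹ := by
        rw [← Complex.ofReal_pow, hsq]; push_cast; rfl
      rw [hsq', Real.coe_toNNReal v hv0]
      congr 1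
      push_cast
      ring
    simp only [this, Finset.prod_const, Finset.card_univ, Fintype.card_fin]
    rw [← Complex.exp_nat_mul]
    congr 1
    have : ((B r : ℕ) : ℂ) ≠ 0 := by exact_mod_cast hr0
    field_simp
  have hdiff : Tendsto (fun r => ∏ b, charFun ρ (q r b) - ∏ b, charFun ρ' (q r b)) atTop
      (𝓝 0) := by
    rw [tendsto_zero_iff_norm_tendsto_zero]
    refine squeeze_zero' (Eventually.of_forall fun _ => norm_nonneg _) ?_ ho'
    filter_upwards [hB.eventually_ge_atTop 1] with r hr
    have hr0 : (0 : ℝ) < B r := by exact_mod_cast hr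
    refine (norm_prod_sub_prod_le_sum _ _ _ (fun _ => norm_charFun_le_one _)
      (fun _ => norm_charFun_le_one _)).trans ?_
    simp only [hnorm, Finset.sum_const, Finset.card_univ, Fintype.card_fin, nsmul_eq_mul]
    simp only [Function.comp_apply]
    -- With `t = 1/√B`, the quotient by `t ^ 2` in `ho'` is `B` times the error of one factor.
    rw [inv_pow, Real.sq_sqrt hr0.le, Real.norm_of_nonneg (inv_nonneg.2 hr0.le), div_inv_eq_mul,
      mul_comm]
  have := hdiff.add (tendsto_const_nhds (x := Complex.exp (-(v : ℂ) / 2)))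
  rw [zero_add] at this
  refine this.congr' ?_
  filter_upwards [hg] with r hr
  rw [hr]; ring

open Filter Topology in
/-- Lévy's continuity theorem on `Fin N → ℝ`, in terms of the dual. -/
theorem tendsto_of_tendsto_charFunDual {N : ℕ} (ν : ℕ → ProbabilityMeasure (Fin N → ℝ))
    (ν₀ : ProbabilityMeasure (Fin N → ℝ))
    (h : ∀ Λ : StrongDual ℝ (Fin N → ℝ),
      Tendsto (fun r => charFunDual (ν r : Measure (Fin N → ℝ)) Λ) atTop
        (𝓝 (charFunDual (ν₀ : Measure (Fin N → ℝ)) Λ))) :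
    Tendsto ν atTop (𝓝 ν₀) := by
  -- `charFun` needs an inner product, while `Fin N → ℝ` carries the sup norm.
  let e : EuclideanSpace ℝ (Fin N) ≃L[ℝ] (Fin N → ℝ) := EuclideanSpace.equiv (Fin N) ℝ
  have he : Continuous e.symm := e.symm.continuous
  have he' : Continuous e := e.continuous
  have h1 : Tendsto (fun r => (ν r).map he.measurable.aemeasurable) atTop
      (𝓝 (ν₀.map he.measurable.aemeasurable)) := by
    refine ProbabilityMeasure.tendsto_of_tendsto_charFun fun t => ?_
    have hc : ∀ σ : ProbabilityMeasure (Fin N → ℝ),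
        charFun ((σ.map he.measurable.aemeasurable : ProbabilityMeasure _) :
          Measure (EuclideanSpace ℝ (Fin N))) t = charFunDual (σ : Measure (Fin N → ℝ))
          ((InnerProductSpace.toDualMap ℝ _ t).comp (e.symm : (Fin N → ℝ) →L[ℝ] _)) := by
      intro σ
      rw [charFun_eq_charFunDual_toDualMap, ← charFunDual_map]
      rfl
    simp only [hc]
    exact h _
  have h2 := ProbabilityMeasure.tendsto_map_of_tendsto_of_continuous _ _ h1 he'
  have hid : ∀ σ : ProbabilityMeasure (Fin N → ℝ),
      (σ.map he.measurable.aemeasurable).map he'.measurable.aemeasurable = σ := by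
    intro σ
    apply Subtype.ext
    simp only [ProbabilityMeasure.val_eq_to_measure, ProbabilityMeasure.toMeasure_map]
    rw [Measure.map_map he'.measurable he.measurable]
    have : (e : EuclideanSpace ℝ (Fin N) → Fin N → ℝ) ∘ e.symm = id := by
      funext x; simp
    rw [this, Measure.map_id]
  simpa only [hid] using h2

/-! ### Flat orthogonal matrices -/

/-- Sylvester's construction: an orthogonal matrix all of whose entries have the same modulus. -/
theorem exists_flat_orthogonal (r : ℕ) : ∃ Q : Matrix (Fin (2 ^ r)) (Fin (2 ^ r)) ℝ,
    (∀ i j, |Q i j| = (√((2 ^ r : ℕ) : ℝ))⁻¹) ∧ Q * Q.transpose = 1 := by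
  induction r with
  | zero =>
    refine ⟨1, fun i j => ?_, by simp⟩
    have : i = j := Subsingleton.elim (α := Fin 1) i j
    subst this
    simp
  | succ r ih =>
    obtain ⟨Q, hQ, hQQ⟩ := ih
    let e : Fin (2 ^ r) ⊕ Fin (2 ^ r) ≃ Fin (2 ^ (r + 1)) :=
      finSumFinEquiv.trans (finCongr (by ring))
    let c : ℝ := (√2)⁻¹
    have hc : c * c = 1 / 2 := by
      simp only [c]
      rw [← mul_inv, Real.mul_self_sqrt (by norm_num)]; norm_num
    let R : Matrix (Fin (2 ^ r)) (Fin (2 ^ r)) ℝ := c • Q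
    have hR : R * R.transpose = (1 / 2 : ℝ) • (1 : Matrix (Fin (2 ^ r)) (Fin (2 ^ r)) ℝ) := by
      simp only [R, Matrix.transpose_smul, Matrix.smul_mul, Matrix.mul_smul, smul_smul, hQQ, hc]
    -- In `M * Mᵀ` the diagonal blocks are `1/2 + 1/2` and the off-diagonal ones cancel.
    let M := Matrix.fromBlocks R R R (-R)
    refine ⟨Matrix.reindex e e M, fun i j => ?_, ?_⟩
    · have hval : ∀ i j, |c * Q i j| = (√((2 ^ (r + 1) : ℕ) : ℝ))⁻¹ := by
        intro i j
        rw [abs_mul, hQ, abs_of_nonneg (by positivity)]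
        simp only [c]
        rw [← mul_inv, ← Real.sqrt_mul (by norm_num)]
        push_cast
        rw [pow_succ, mul_comm]
      rw [Matrix.reindex_apply, Matrix.submatrix_apply]
      rcases e.symm i with a | a <;> rcases e.symm j with b | b <;>
        simp [M, R, hval, -abs_mul]
    · have hM : M * M.transpose = 1 := by
        simp only [M, Matrix.fromBlocks_transpose, Matrix.fromBlocks_multiply,
          Matrix.transpose_neg, Matrix.mul_neg, Matrix.neg_mul, hR, neg_neg, ← add_smul]
        norm_num [Matrix.fromBlocks_one]
      rw [Matrix.transpose_reindex, Matrix.reindex_apply, Matrix.reindex_apply,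
        Matrix.submatrix_mul_equiv, hM, Matrix.submatrix_one_equiv]

/-! ### Reindexing product measures -/

/-- A subfamily of an i.i.d. family is i.i.d. -/
theorem pi_map_comp_injective {ι κ E : Type*} [Fintype ι] [Fintype κ] [MeasurableSpace E]
    (ν : Measure E) [IsProbabilityMeasure ν] (g : ι → κ) (hg : Function.Injective g) :
    (Measure.pi (fun _ : κ => ν)).map (fun z i => z (g i)) = Measure.pi (fun _ : ι => ν) := by
  have h1 : iIndepFun (fun (i : κ) (z : κ → E) => z i) (Measure.pi fun _ : κ => ν) :=
    iIndepFun_pi (X := fun _ => id) (fun _ => aemeasurable_id)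
  have h2 := h1.precomp hg
  rw [iIndepFun_iff_map_fun_eq_pi_map (fun i => (measurable_pi_apply _).aemeasurable)] at h2
  rw [h2]
  congr 1
  funext i
  exact (measurePreserving_eval (fun _ : κ => ν) (g i)).map_eq

theorem pi_map_curry {ι κ E : Type*} [Fintype ι] [Fintype κ] [MeasurableSpace E]
    (ν : Measure E) [IsProbabilityMeasure ν] :
    (Measure.pi (fun _ : ι × κ => ν)).map (fun z i j => z (i, j))
      = Measure.pi (fun _ : ι => Measure.pi (fun _ : κ => ν)) := by
  have := Measure.infinitePi_map_curry (fun (_ : ι) (_ : κ) => ν)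
  simp only [Measure.infinitePi_eq_pi] at this
  exact this

/-! ### Moments of linear functionals and the vector central limit theorem -/

/-- The coordinatewise mean of a law on `Fin N → ℝ`. -/
noncomputable def meanVector {N : ℕ} (μ : Measure (Fin N → ℝ)) : Fin N → ℝ := fun i => ∫ z, z i ∂μ

theorem strongDual_apply_eq_sum {N : ℕ} (Λ : StrongDual ℝ (Fin N → ℝ)) (z : Fin N → ℝ) :
    Λ z = ∑ i, Λ (Pi.single i 1) * z i := by
  have := LinearMap.pi_apply_eq_sum_univ (Λ : (Fin N → ℝ) →ₗ[ℝ] ℝ) z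
  simp only [ContinuousLinearMap.coe_coe, smul_eq_mul] at this
  rw [this]
  refine Finset.sum_congr rfl fun i _ => ?_
  rw [mul_comm]
  congr 2
  funext j
  simp [Pi.single_apply, eq_comm]

namespace HasCovarianceMatrix

variable {N : ℕ} {μ : Measure (Fin N → ℝ)} {K : Matrix (Fin N) (Fin N) ℝ}

theorem memLp_dual (h : HasCovarianceMatrix μ K) (Λ : StrongDual ℝ (Fin N → ℝ)) :
    MemLp Λ 2 μ := by
  have : (Λ : (Fin N → ℝ) → ℝ) = fun z => ∑ i, Λ (Pi.single i 1) * z i :=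
    funext (strongDual_apply_eq_sum Λ)
  rw [this]
  exact memLp_finsetSum _ fun i _ => (h.memLp i).const_mul _

theorem integral_dual [IsProbabilityMeasure μ] (h : HasCovarianceMatrix μ K)
    (Λ : StrongDual ℝ (Fin N → ℝ)) : ∫ z, Λ z ∂μ = Λ (meanVector μ) := by
  rw [integral_congr_ae (Filter.Eventually.of_forall (strongDual_apply_eq_sum Λ)),
    strongDual_apply_eq_sum Λ (meanVector μ), integral_finsetSum _ fun i _ =>
    (((h.memLp i).integrable (by norm_num)).const_mul _)]
  simp only [integral_const_mul, meanVector]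

/-- The right side involves `μ` only through `K`, so laws with equal covariance matrices give each
functional the same variance. -/
theorem variance_dual [IsProbabilityMeasure μ] (h : HasCovarianceMatrix μ K)
    (Λ : StrongDual ℝ (Fin N → ℝ)) :
    Var[Λ; μ] = ∑ i, ∑ j, Λ (Pi.single i 1) * (Λ (Pi.single j 1) * K i j) := by
  have : (Λ : (Fin N → ℝ) → ℝ) = ∑ i, fun z : Fin N → ℝ => Λ (Pi.single i 1) * z i := by
    funext z
    rw [strongDual_apply_eq_sum Λ]
    simp
  rw [this, variance_sum' fun i _ => (h.memLp i).const_mul _]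
  refine Finset.sum_congr rfl fun i _ => Finset.sum_congr rfl fun j _ => ?_
  rw [covariance_const_mul_left, covariance_const_mul_right, h.cov_eq, ← this]

end HasCovarianceMatrix

/-- The combination `∑ b, q b * z b + o` of the vectors `z b`. -/
noncomputable def weightedSum {B N : ℕ} (q : Fin B → ℝ) (o : Fin N → ℝ) (z : Fin B → Fin N → ℝ) :
    Fin N → ℝ := fun i => ∑ b, q b * z b i + o i

theorem measurable_weightedSum {B N : ℕ} (q : Fin B → ℝ) (o : Fin N → ℝ) :
    Measurable (weightedSum q o) := by
  unfold weightedSum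
  fun_prop

/-- The offset that gives a weighted sum of vectors with mean `a` the mean `c`. -/
noncomputable def meanOffset {B N : ℕ} (q : Fin B → ℝ) (a c : Fin N → ℝ) : Fin N → ℝ :=
  fun i => c i - ∑ b, q b * a i

/-- The law of a weighted sum of i.i.d. vectors with law `μ`, shifted to have mean `c`. -/
noncomputable def weightedSumLaw {B N : ℕ} (μ : Measure (Fin N → ℝ)) [IsProbabilityMeasure μ]
    (q : Fin B → ℝ) (c : Fin N → ℝ) : ProbabilityMeasure (Fin N → ℝ) :=
  ⟨(Measure.pi fun _ : Fin B => μ).map (weightedSum q (meanOffset q (meanVector μ) c)),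
    Measure.isProbabilityMeasure_map (measurable_weightedSum _ _).aemeasurable⟩

/-- The offset turns the sum into `∑ b, q b • (z b - meanVector μ) + c`; independence then
factorises the expectation into centred scalar characteristic functions. -/
theorem charFunDual_weightedSumLaw {B N : ℕ} (μ : Measure (Fin N → ℝ)) [IsProbabilityMeasure μ]
    (q : Fin B → ℝ) (c : Fin N → ℝ) (Λ : StrongDual ℝ (Fin N → ℝ)) :
    charFunDual (weightedSumLaw μ q c : Measure (Fin N → ℝ)) Λ
      = Complex.exp (Λ c * Complex.I)
        * ∏ b, charFun (μ.map fun z => Λ z - Λ (meanVector μ)) (q b) := by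
  have hlin : ∀ z, Λ (weightedSum q (meanOffset q (meanVector μ) c) z)
      = (∑ b, q b * (Λ (z b) - Λ (meanVector μ))) + Λ c := by
    intro z
    have : weightedSum q (meanOffset q (meanVector μ) c) z
        = (∑ b, q b • (z b - meanVector μ)) + c := by
      funext i
      simp only [weightedSum, meanOffset, Pi.add_apply, Finset.sum_apply, Pi.smul_apply,
        Pi.sub_apply, smul_eq_mul, mul_sub, Finset.sum_sub_distrib]
      ring
    rw [this]
    simp only [map_add, map_sum, map_smul, map_sub, smul_eq_mul]
  rw [charFunDual_apply]
  change ∫ v, _ ∂((Measure.pi fun _ : Fin B => μ).map _) = _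
  rw [integral_map (measurable_weightedSum _ _).aemeasurable
    (by exact (Continuous.aestronglyMeasurable (by fun_prop)))]
  have hexp : ∀ z : Fin B → Fin N → ℝ,
      Complex.exp (Λ (weightedSum q (meanOffset q (meanVector μ) c) z) * Complex.I)
      = Complex.exp (Λ c * Complex.I)
        * ∏ b, Complex.exp ((q b : ℂ) * ((Λ (z b) - Λ (meanVector μ) : ℝ) : ℂ) * Complex.I) := by
    intro z
    rw [hlin, ← Complex.exp_sum, ← Complex.exp_add]
    congr 1
    push_cast
    rw [add_mul, Finset.sum_mul, add_comm]
  simp only [hexp]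
  rw [integral_const_mul, integral_fintype_prod_eq_prod
    (f := fun b (z : Fin N → ℝ) =>
      Complex.exp ((q b : ℂ) * ((Λ z - Λ (meanVector μ) : ℝ) : ℂ) * Complex.I))]
  congr 1
  refine Finset.prod_congr rfl fun b _ => ?_
  rw [charFun_apply_real, integral_map (by fun_prop) (by fun_prop)]

open Filter Topology in
/-- Central limit theorem for equally weighted signed sums of random vectors. -/
theorem tendsto_weightedSumLaw {N : ℕ} (K : Matrix (Fin N) (Fin N) ℝ)
    (γ : Measure (Fin N → ℝ)) [IsGaussian γ] (hγ : HasCovarianceMatrix γ K)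
    (μ : Measure (Fin N → ℝ)) [IsProbabilityMeasure μ] (hμ : HasCovarianceMatrix μ K)
    {B : ℕ → ℕ} (hB : Tendsto B atTop atTop) (q : ∀ r, Fin (B r) → ℝ)
    (hq : ∀ r b, |q r b| = (√(B r))⁻¹) :
    Tendsto (fun r => weightedSumLaw μ (q r) (meanVector γ)) atTop
      (𝓝 (⟨γ, inferInstance⟩ : ProbabilityMeasure (Fin N → ℝ))) := by
  refine tendsto_of_tendsto_charFunDual _ _ fun Λ => ?_
  simp only [charFunDual_weightedSumLaw]
  change Tendsto _ _ (𝓝 (charFunDual γ Λ))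
  have hmeas : Measurable fun z => Λ z - Λ (meanVector μ) := by fun_prop
  have : IsProbabilityMeasure (μ.map fun z => Λ z - Λ (meanVector μ)) :=
    Measure.isProbabilityMeasure_map hmeas.aemeasurable
  have hm2 : MemLp (fun z => Λ z - Λ (meanVector μ)) 2 μ :=
    (hμ.memLp_dual Λ).sub (memLp_const _)
  have h2 : MemLp id 2 (μ.map fun z => Λ z - Λ (meanVector μ)) := by
    rw [memLp_map_measure_iff aestronglyMeasurable_id hmeas.aemeasurable]
    exact hm2
  have h1 : ∫ x, x ∂(μ.map fun z => Λ z - Λ (meanVector μ)) = 0 := by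
    rw [integral_map hmeas.aemeasurable (by fun_prop),
      integral_sub ((hμ.memLp_dual Λ).integrable (by norm_num)) (integrable_const _),
      hμ.integral_dual]
    simp
  have hv : ∫ x, x ^ 2 ∂(μ.map fun z => Λ z - Λ (meanVector μ)) = Var[Λ; γ] := by
    rw [integral_map hmeas.aemeasurable (by fun_prop), hγ.variance_dual, ← hμ.variance_dual,
      variance_eq_integral (by fun_prop), hμ.integral_dual]
  have := (tendsto_prod_charFun_signed _ h2 h1 hB q hq).const_mul
    (Complex.exp (Λ (meanVector γ) * Complex.I))
  rw [hv, ← Complex.exp_add] at this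
  rw [IsGaussian.charFunDual_eq, integral_complex_ofReal, hγ.integral_dual]
  convert this using 3
  ring

/-! ### Signals of a scheme: recursion and measurability -/

namespace CodingScheme

variable {k R N n : ℕ}

/-- The signals received by node `i` before time `t`. -/
noncomputable def past (C : CodingScheme k R n) (L : NodeLayout k R N)
    (H : Matrix (Fin N) (Fin N) ℝ) (x : Fin n → Fin k → ℝ) (z : Fin n → Fin N → ℝ)
    (t : Fin n) (i : Fin N) : Fin (t : ℕ) → ℝ :=
  fun τ => C.received L H x z ⟨τ, τ.isLt.trans t.isLt⟩ i

theorem received_eq (C : CodingScheme k R n) (L : NodeLayout k R N)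
    (H : Matrix (Fin N) (Fin N) ℝ) (x : Fin n → Fin k → ℝ) (z : Fin n → Fin N → ℝ)
    (t : Fin n) (i : Fin N) :
    C.received L H x z t i
      = (∑ j, H i j * C.transmit L x t j (C.past L H x z t j)) + z t i := by
  rw [received]
  rfl

theorem measurable_transmit (C : CodingScheme k R n) (L : NodeLayout k R N) (t : Fin n)
    (i : Fin N) : Measurable fun p : (Fin n → Fin k → ℝ) × (Fin (t : ℕ) → ℝ) =>
      C.transmit L p.1 t i p.2 := by
  unfold transmit
  rcases L.node.symm i with m | m | p
  · have h : Measurable fun p : (Fin n → Fin k → ℝ) × (Fin (t : ℕ) → ℝ) =>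
        ((fun τ => p.1 τ m, p.2) : (Fin n → ℝ) × (Fin (t : ℕ) → ℝ)) := by fun_prop
    exact (C.measurable_srcEnc m t).comp h
  · exact (C.measurable_dstEnc m t).comp measurable_snd
  · exact (C.measurable_relayEnc p t).comp measurable_snd

theorem measurable_received (C : CodingScheme k R n) (L : NodeLayout k R N)
    (H : Matrix (Fin N) (Fin N) ℝ) (t : Fin n) (i : Fin N) :
    Measurable fun ω : (Fin n → Fin k → ℝ) × (Fin n → Fin N → ℝ) =>
      C.received L H ω.1 ω.2 t i := by
  obtain ⟨t, ht⟩ := t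
  induction t using Nat.strong_induction_on generalizing i with
  | _ t ih =>
    simp only [received_eq C L H _ _ ⟨t, ht⟩]
    refine (Finset.measurable_sum _ fun j _ => Measurable.const_mul ?_ _).add (by fun_prop)
    have hp : Measurable fun ω : (Fin n → Fin k → ℝ) × (Fin n → Fin N → ℝ) =>
        C.past L H ω.1 ω.2 ⟨t, ht⟩ j :=
      measurable_pi_lambda _ fun τ => ih τ τ.isLt j (τ.isLt.trans ht)
    exact (C.measurable_transmit L ⟨t, ht⟩ j).comp (measurable_fst.prodMk hp)

theorem measurable_past (C : CodingScheme k R n) (L : NodeLayout k R N)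
    (H : Matrix (Fin N) (Fin N) ℝ) (t : Fin n) (i : Fin N) :
    Measurable fun ω : (Fin n → Fin k → ℝ) × (Fin n → Fin N → ℝ) =>
      C.past L H ω.1 ω.2 t i :=
  measurable_pi_lambda _ fun _ => C.measurable_received L H _ i

theorem measurable_dstReceived (C : CodingScheme k R n) (L : NodeLayout k R N)
    (H : Matrix (Fin N) (Fin N) ℝ) (i : Fin N) :
    Measurable fun ω : (Fin n → Fin k → ℝ) × (Fin n → Fin N → ℝ) =>
      fun t => C.received L H ω.1 ω.2 t i :=
  measurable_pi_lambda _ fun t => C.measurable_received L H t i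

theorem measurable_estimate (C : CodingScheme k R n) (L : NodeLayout k R N)
    (H : Matrix (Fin N) (Fin N) ℝ) (m : Fin k) (t : Fin n) :
    Measurable fun ω : (Fin n → Fin k → ℝ) × (Fin n → Fin N → ℝ) =>
      C.estimate L H ω.1 ω.2 m t :=
  (measurable_pi_apply t).comp ((C.measurable_dec m).comp (C.measurable_dstReceived L H (L.dst m)))

theorem measurable_blockDistortion (C : CodingScheme k R n) (L : NodeLayout k R N)
    (H : Matrix (Fin N) (Fin N) ℝ) (m : Fin k) :
    Measurable (C.blockDistortion quadraticDistortion L H m) := by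
  unfold blockDistortion quadraticDistortion
  exact Finset.measurable_sum _ fun t _ =>
    ((by fun_prop : Measurable fun ω : (Fin n → Fin k → ℝ) × (Fin n → Fin N → ℝ) =>
      ω.1 t m).sub (C.measurable_estimate L H m t)).pow_const 2

/-! ### Causality, continuity and domination -/

/-- All encoding functions used at time `t` are continuous. -/
structure ContinuousAtTime (C : CodingScheme k R n) (t : Fin n) : Prop where
  src : ∀ m, Continuous fun p : (Fin n → ℝ) × (Fin (t : ℕ) → ℝ) => C.srcEnc m t p.1 p.2
  relay : ∀ p, Continuous (C.relayEnc p t)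
  dst : ∀ m, Continuous (C.dstEnc m t)

theorem ContinuousAtTime.transmit {C : CodingScheme k R n} {t : Fin n} (h : C.ContinuousAtTime t)
    (L : NodeLayout k R N) (x : Fin n → Fin k → ℝ) (i : Fin N) :
    Continuous fun y => C.transmit L x t i y := by
  unfold CodingScheme.transmit
  rcases L.node.symm i with m | m | p
  · exact (h.src m).comp (by fun_prop : Continuous fun y : Fin (t : ℕ) → ℝ =>
      (((fun τ => x τ m), y) : (Fin n → ℝ) × (Fin (t : ℕ) → ℝ)))
  · exact h.dst m
  · exact h.relay p

/-- The decoding functions are continuous and bounded by `M`. -/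
structure HasBoundedContinuousDec (C : CodingScheme k R n) (M : ℝ) : Prop where
  cont : ∀ m, Continuous (C.dec m)
  bound : ∀ m y t, |C.dec m y t| ≤ M

/-- Two schemes use the same encoding functions before time `T`. -/
structure AgreeBefore (A C : CodingScheme k R n) (T : ℕ) : Prop where
  src : ∀ m (t : Fin n), (t : ℕ) < T → A.srcEnc m t = C.srcEnc m t
  relay : ∀ p (t : Fin n), (t : ℕ) < T → A.relayEnc p t = C.relayEnc p t
  dst : ∀ m (t : Fin n), (t : ℕ) < T → A.dstEnc m t = C.dstEnc m t

theorem AgreeBefore.transmit {A C : CodingScheme k R n} {T : ℕ} (h : A.AgreeBefore C T)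
    (L : NodeLayout k R N) (x : Fin n → Fin k → ℝ) {t : Fin n} (ht : (t : ℕ) < T) (i : Fin N)
    (y : Fin (t : ℕ) → ℝ) : A.transmit L x t i y = C.transmit L x t i y := by
  unfold CodingScheme.transmit
  simp only [h.src _ t ht, h.relay _ t ht, h.dst _ t ht]

theorem AgreeBefore.received {A C : CodingScheme k R n} {T : ℕ} (h : A.AgreeBefore C T)
    (L : NodeLayout k R N) (H : Matrix (Fin N) (Fin N) ℝ) (x : Fin n → Fin k → ℝ)
    (z : Fin n → Fin N → ℝ) {t : Fin n} (ht : (t : ℕ) < T) (i : Fin N) :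
    A.received L H x z t i = C.received L H x z t i := by
  obtain ⟨t, htn⟩ := t
  induction t using Nat.strong_induction_on generalizing i with
  | _ t ih =>
    rw [received_eq, received_eq]
    congr 1
    refine Finset.sum_congr rfl fun j _ => ?_
    have hp : A.past L H x z ⟨t, htn⟩ j = C.past L H x z ⟨t, htn⟩ j :=
      funext fun τ => ih τ τ.isLt j (τ.isLt.trans htn) (τ.isLt.trans ht)
    rw [hp, h.transmit L x ht]

/-- `t = T` is allowed: the past at time `T` uses only encoders of earlier times. -/
theorem AgreeBefore.past {A C : CodingScheme k R n} {T : ℕ} (h : A.AgreeBefore C T)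
    (L : NodeLayout k R N) (H : Matrix (Fin N) (Fin N) ℝ) (x : Fin n → Fin k → ℝ)
    (z : Fin n → Fin N → ℝ) {t : Fin n} (ht : (t : ℕ) ≤ T) (i : Fin N) :
    A.past L H x z t i = C.past L H x z t i :=
  funext fun τ => h.received L H x z (τ.isLt.trans_le ht) i

/-- The scheme `A` with the encoding functions of time `T` replaced by those of `D`. -/
def replaceAt (A D : CodingScheme k R n) (T : ℕ) : CodingScheme k R n where
  srcEnc m t := if (t : ℕ) = T then D.srcEnc m t else A.srcEnc m t
  relayEnc p t := if (t : ℕ) = T then D.relayEnc p t else A.relayEnc p t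
  dstEnc m t := if (t : ℕ) = T then D.dstEnc m t else A.dstEnc m t
  dec := A.dec
  measurable_srcEnc m t := by
    split_ifs
    exacts [D.measurable_srcEnc m t, A.measurable_srcEnc m t]
  measurable_relayEnc p t := by
    split_ifs
    exacts [D.measurable_relayEnc p t, A.measurable_relayEnc p t]
  measurable_dstEnc m t := by
    split_ifs
    exacts [D.measurable_dstEnc m t, A.measurable_dstEnc m t]
  measurable_dec := A.measurable_dec

theorem replaceAt_transmit_self (A D : CodingScheme k R n) {T : ℕ} (L : NodeLayout k R N)
    (x : Fin n → Fin k → ℝ) {t : Fin n} (ht : (t : ℕ) = T) (i : Fin N) (y : Fin (t : ℕ) → ℝ) :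
    (A.replaceAt D T).transmit L x t i y = D.transmit L x t i y := by
  simp only [transmit, replaceAt, if_pos ht]

theorem replaceAt_transmit_of_ne (A D : CodingScheme k R n) {T : ℕ} (L : NodeLayout k R N)
    (x : Fin n → Fin k → ℝ) {t : Fin n} (ht : (t : ℕ) ≠ T) (i : Fin N) (y : Fin (t : ℕ) → ℝ) :
    (A.replaceAt D T).transmit L x t i y = A.transmit L x t i y := by
  simp only [transmit, replaceAt, if_neg ht]

theorem replaceAt_agreeBefore (A D : CodingScheme k R n) (T : ℕ) :
    (A.replaceAt D T).AgreeBefore A T where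
  src _ _ ht := if_neg ht.ne
  relay _ _ ht := if_neg ht.ne
  dst _ _ ht := if_neg ht.ne

theorem AgreeBefore.trans {A B C : CodingScheme k R n} {T : ℕ} (h : A.AgreeBefore B T)
    (h' : B.AgreeBefore C T) : A.AgreeBefore C T where
  src m t ht := (h.src m t ht).trans (h'.src m t ht)
  relay m t ht := (h.relay m t ht).trans (h'.relay m t ht)
  dst m t ht := (h.dst m t ht).trans (h'.dst m t ht)

theorem AgreeBefore.mono {A C : CodingScheme k R n} {S T : ℕ} (h : A.AgreeBefore C T)
    (hST : S ≤ T) : A.AgreeBefore C S where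
  src m t ht := h.src m t (ht.trans_le hST)
  relay m t ht := h.relay m t (ht.trans_le hST)
  dst m t ht := h.dst m t (ht.trans_le hST)

theorem replaceAt_continuousAtTime {A D : CodingScheme k R n} {T : ℕ}
    (hD : ∀ t, D.ContinuousAtTime t) (hA : ∀ t : Fin n, T + 1 ≤ (t : ℕ) → A.ContinuousAtTime t)
    (t : Fin n) (ht : T ≤ (t : ℕ)) : (A.replaceAt D T).ContinuousAtTime t := by
  rcases eq_or_ne (t : ℕ) T with h | h
  · constructor
    · intro m
      simp only [replaceAt, if_pos h]
      exact (hD t).src m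
    · intro m
      simp only [replaceAt, if_pos h]
      exact (hD t).relay m
    · intro m
      simp only [replaceAt, if_pos h]
      exact (hD t).dst m
  · have hA' := hA t (by omega)
    constructor
    · intro m
      simp only [replaceAt, if_neg h]
      exact hA'.src m
    · intro m
      simp only [replaceAt, if_neg h]
      exact hA'.relay m
    · intro m
      simp only [replaceAt, if_neg h]
      exact hA'.dst m

open Filter Topology in
/-- The received signals depend continuously on the encoding functions of time `T`, if all later
encoding functions are continuous. -/
theorem tendsto_received_replaceAt (A : CodingScheme k R n) (D : ℕ → CodingScheme k R n) {T : ℕ}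
    (hA : ∀ t : Fin n, T + 1 ≤ (t : ℕ) → A.ContinuousAtTime t) (L : NodeLayout k R N)
    (H : Matrix (Fin N) (Fin N) ℝ) (x : Fin n → Fin k → ℝ) (z : Fin n → Fin N → ℝ)
    (hlim : ∀ t : Fin n, (t : ℕ) = T → ∀ i, Tendsto
      (fun l => (D l).transmit L x t i (A.past L H x z t i)) atTop
      (𝓝 (A.transmit L x t i (A.past L H x z t i)))) (t : Fin n) (i : Fin N) :
    Tendsto (fun l => (A.replaceAt (D l) T).received L H x z t i) atTop
      (𝓝 (A.received L H x z t i)) := by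
  obtain ⟨t, htn⟩ := t
  induction t using Nat.strong_induction_on generalizing i with
  | _ t ih =>
    simp only [received_eq _ L H x z ⟨t, htn⟩]
    refine (tendsto_finsetSum _ fun j _ => Tendsto.const_mul _ ?_).add tendsto_const_nhds
    -- Before `T` nothing changes; at `T` the encoders converge on an unchanged past; after `T`
    -- continuity carries the convergence of the past through the encoder.
    rcases lt_trichotomy t T with h | h | h
    · refine tendsto_const_nhds.congr fun l => ?_
      rw [(replaceAt_agreeBefore A (D l) T).transmit L x h,
        (replaceAt_agreeBefore A (D l) T).past L H x z h.le]
    · refine (hlim ⟨t, htn⟩ h j).congr fun l => ?_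
      rw [replaceAt_transmit_self A (D l) L x h,
        (replaceAt_agreeBefore A (D l) T).past L H x z h.le]
    · have hp : Tendsto (fun l => (A.replaceAt (D l) T).past L H x z ⟨t, htn⟩ j) atTop
          (𝓝 (A.past L H x z ⟨t, htn⟩ j)) :=
        tendsto_pi_nhds.2 fun τ => ih τ τ.isLt j (τ.isLt.trans htn)
      refine ((((hA ⟨t, htn⟩ h).transmit L x j).tendsto _).comp hp).congr fun l => ?_
      rw [Function.comp_apply, replaceAt_transmit_of_ne A (D l) L x (by simpa using h.ne')]

theorem continuous_received {A : CodingScheme k R n} (hA : ∀ t, A.ContinuousAtTime t)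
    (L : NodeLayout k R N) (H : Matrix (Fin N) (Fin N) ℝ) (x : Fin n → Fin k → ℝ) (t : Fin n)
    (i : Fin N) : Continuous fun z => A.received L H x z t i := by
  obtain ⟨t, htn⟩ := t
  induction t using Nat.strong_induction_on generalizing i with
  | _ t ih =>
    simp only [received_eq _ L H x _ ⟨t, htn⟩]
    refine (continuous_finsetSum _ fun j _ => Continuous.mul continuous_const ?_).add
      (by fun_prop)
    exact ((hA ⟨t, htn⟩).transmit L x j).comp
      (continuous_pi fun τ => ih τ τ.isLt j (τ.isLt.trans htn))

theorem continuous_blockDistortion {A : CodingScheme k R n} (hA : ∀ t, A.ContinuousAtTime t)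
    {M : ℝ} (hM : A.HasBoundedContinuousDec M) (L : NodeLayout k R N)
    (H : Matrix (Fin N) (Fin N) ℝ) (m : Fin k) (x : Fin n → Fin k → ℝ) :
    Continuous fun z => A.blockDistortion quadraticDistortion L H m (x, z) := by
  unfold blockDistortion quadraticDistortion estimate
  refine continuous_finsetSum _ fun t _ => ((continuous_const).sub ?_).pow 2
  exact (continuous_apply t).comp ((hM.cont m).comp
    (continuous_pi fun t => continuous_received hA L H x t (L.dst m)))

theorem blockDistortion_nonneg (A : CodingScheme k R n) (L : NodeLayout k R N)
    (H : Matrix (Fin N) (Fin N) ℝ) (m : Fin k)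
    (ω : (Fin n → Fin k → ℝ) × (Fin n → Fin N → ℝ)) :
    0 ≤ A.blockDistortion quadraticDistortion L H m ω :=
  Finset.sum_nonneg fun _ _ => sq_nonneg _

/-- An upper bound, not depending on the noise, for the distortion of a scheme with bounded
decoding functions. -/
noncomputable def distortionBound (M : ℝ) (m : Fin k) (x : Fin n → Fin k → ℝ) : ℝ :=
  ∑ t, (2 * (x t m) ^ 2 + 2 * M ^ 2)

theorem blockDistortion_le {A : CodingScheme k R n} {M : ℝ} (hM : A.HasBoundedContinuousDec M)
    (L : NodeLayout k R N) (H : Matrix (Fin N) (Fin N) ℝ) (m : Fin k)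
    (ω : (Fin n → Fin k → ℝ) × (Fin n → Fin N → ℝ)) :
    A.blockDistortion quadraticDistortion L H m ω ≤ distortionBound M m ω.1 := by
  refine Finset.sum_le_sum fun t _ => ?_
  unfold quadraticDistortion
  have h1 : (A.estimate L H ω.1 ω.2 m t) ^ 2 ≤ M ^ 2 := by
    rw [sq_le_sq]
    exact (hM.bound m _ t).trans (le_abs_self M)
  -- From `(x - e)² + (x + e)² = 2x² + 2e²`.
  nlinarith [sq_nonneg (ω.1 t m + A.estimate L H ω.1 ω.2 m t)]

theorem integrable_distortionBound (P : Measure (Fin k → ℝ)) [IsProbabilityMeasure P]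
    (hP : ∀ m, MemLp (fun x : Fin k → ℝ => x m) 2 P) (M : ℝ) (m : Fin k) :
    Integrable (distortionBound (n := n) M m) (Measure.pi fun _ : Fin n => P) := by
  unfold distortionBound
  refine integrable_finsetSum _ fun t _ => Integrable.add (Integrable.const_mul ?_ _)
    (integrable_const _)
  exact (measurePreserving_eval (fun _ : Fin n => P) t).integrable_comp_of_integrable
    (hP m).integrable_sq

theorem integrable_blockDistortion {A : CodingScheme k R n} {M : ℝ}
    (hM : A.HasBoundedContinuousDec M) (L : NodeLayout k R N) (H : Matrix (Fin N) (Fin N) ℝ)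
    (P : Measure (Fin k → ℝ)) [IsProbabilityMeasure P]
    (hP : ∀ m, MemLp (fun x : Fin k → ℝ => x m) 2 P)
    (σ : Measure (Fin n → Fin N → ℝ)) [IsProbabilityMeasure σ] (m : Fin k) :
    Integrable (A.blockDistortion quadraticDistortion L H m)
      ((Measure.pi fun _ : Fin n => P).prod σ) := by
  refine ((integrable_distortionBound P hP M m).comp_fst σ).mono'
    (A.measurable_blockDistortion L H m).aestronglyMeasurable
    (Filter.Eventually.of_forall fun ω => ?_)
  rw [Real.norm_of_nonneg (A.blockDistortion_nonneg L H m ω)]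
  exact blockDistortion_le hM L H m ω

end CodingScheme

/-! ### Passage to continuous schemes -/

/-- In the mean square sense, an estimator can be replaced by a bounded continuous one. -/
theorem exists_boundedContinuous_integral_sq_le {Ω E : Type*} [MeasurableSpace Ω]
    [TopologicalSpace E] [NormalSpace E] [MeasurableSpace E] [BorelSpace E]
    (ρ : Measure Ω) [IsProbabilityMeasure ρ] {X : Ω → ℝ} (hX : MemLp X 2 ρ) {Y : Ω → E}
    (hY : Measurable Y) [(ρ.map Y).WeaklyRegular] {g : E → ℝ} (hg : Measurable g)
    (hint : Integrable (fun ω => (X ω - g (Y ω)) ^ 2) ρ) {ε : ℝ} (hε : 0 < ε) :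
    ∃ h : BoundedContinuousFunction E ℝ,
      ∫ ω, (X ω - h (Y ω)) ^ 2 ∂ρ ≤ ∫ ω, (X ω - g (Y ω)) ^ 2 ∂ρ + ε := by
  have := Measure.isProbabilityMeasure_map (μ := ρ) hY.aemeasurable
  have hXg : MemLp (fun ω => X ω - g (Y ω)) 2 ρ :=
    (memLp_two_iff_integrable_sq
      (hX.aestronglyMeasurable.sub (hg.comp hY).aestronglyMeasurable)).2 hint
  have hgY : MemLp (fun ω => g (Y ω)) 2 ρ := by
    have := hX.sub hXg
    refine this.congr_norm (hg.comp hY).aestronglyMeasurable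
      (Filter.Eventually.of_forall fun ω => ?_)
    simp
  have hgm : MemLp g (ENNReal.ofReal 2) (ρ.map Y) := by
    rw [memLp_map_measure_iff hg.aestronglyMeasurable hY.aemeasurable]
    rw [ENNReal.ofReal_ofNat]
    exact hgY
  set I := ∫ ω, (X ω - g (Y ω)) ^ 2 ∂ρ with hI
  have hI0 : 0 ≤ I := integral_nonneg fun ω => sq_nonneg _
  -- Weights for `(a + b)² ≤ (1 + δ) a² + (1 + 1/δ) b²`, with `a = X - g` and `b = g - h`: `δ` makes
  -- `δ * I ≤ ε / 2`, and `η` makes the `b²` term at most `ε / 2`.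
  let δ : ℝ := ε / (2 * (I + 1))
  have hδ : 0 < δ := by positivity
  let η : ℝ := (ε / 2) / (1 + 1 / δ)
  have hη : 0 < η := by positivity
  obtain ⟨h, hh, -⟩ := hgm.exists_boundedContinuous_integral_rpow_sub_le (by norm_num) hη
  refine ⟨h, ?_⟩
  have hhY : MemLp (fun ω => h (Y ω)) 2 ρ :=
    MemLp.of_bound (h.continuous.measurable.comp hY).aestronglyMeasurable ‖h‖
      (Filter.Eventually.of_forall fun ω => h.norm_coe_le_norm _)
  have hgh : Integrable (fun ω => (g (Y ω) - h (Y ω)) ^ 2) ρ := (hgY.sub hhY).integrable_sq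
  have hh' : ∫ ω, (g (Y ω) - h (Y ω)) ^ 2 ∂ρ ≤ η := by
    have h2 : ∫ y, (g y - h y) ^ 2 ∂(ρ.map Y) ≤ η := by
      simpa [Real.rpow_two, sq_abs] using hh
    have hm : Measurable fun y => (g y - h y) ^ 2 :=
      (hg.sub h.continuous.measurable).pow_const 2
    rwa [integral_map hY.aemeasurable hm.aestronglyMeasurable] at h2
  have hle : ∫ ω, (X ω - h (Y ω)) ^ 2 ∂ρ
      ≤ ∫ ω, ((1 + δ) * (X ω - g (Y ω)) ^ 2 + (1 + 1 / δ) * (g (Y ω) - h (Y ω)) ^ 2) ∂ρ := by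
    refine integral_mono (hX.sub hhY).integrable_sq ((hint.const_mul _).add (hgh.const_mul _))
      fun ω => ?_
    have hs := sq_nonneg (δ * (X ω - g (Y ω)) - (g (Y ω) - h (Y ω)))
    have : 0 ≤ 1 / δ * (δ * (X ω - g (Y ω)) - (g (Y ω) - h (Y ω))) ^ 2 := by positivity
    have he : 1 / δ * (δ * (X ω - g (Y ω)) - (g (Y ω) - h (Y ω))) ^ 2
        = (1 + δ) * (X ω - g (Y ω)) ^ 2 + (1 + 1 / δ) * (g (Y ω) - h (Y ω)) ^ 2
          - (X ω - h (Y ω)) ^ 2 := by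
      field_simp
      ring
    simp only
    linarith
  rw [integral_add (hint.const_mul _) (hgh.const_mul _), integral_const_mul,
    integral_const_mul] at hle
  have h1 : δ * I ≤ ε / 2 := by
    have : δ * (I + 1) = ε / 2 := by simp only [δ]; field_simp
    nlinarith
  have h2 : (1 + 1 / δ) * ∫ ω, (g (Y ω) - h (Y ω)) ^ 2 ∂ρ ≤ ε / 2 := by
    calc _ ≤ (1 + 1 / δ) * η := by gcongr
      _ = ε / 2 := by simp only [η]; field_simp
  linarith

instance {k N n : ℕ} (P : Measure (Fin k → ℝ)) [IsProbabilityMeasure P]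
    (μ : Measure (Fin N → ℝ)) [IsProbabilityMeasure μ] : IsProbabilityMeasure (blockLaw P μ n) := by
  unfold blockLaw
  infer_instance

theorem memLp_source_blockLaw {k N n : ℕ} (P : Measure (Fin k → ℝ)) [IsProbabilityMeasure P]
    (hP : ∀ m, MemLp (fun x : Fin k → ℝ => x m) 2 P)
    (μ : Measure (Fin N → ℝ)) [IsProbabilityMeasure μ] (t : Fin n) (m : Fin k) :
    MemLp (fun ω : (Fin n → Fin k → ℝ) × (Fin n → Fin N → ℝ) => ω.1 t m) 2 (blockLaw P μ n) := by
  have h1 : MemLp (fun x : Fin n → Fin k → ℝ => x t m) 2 (Measure.pi fun _ : Fin n => P) :=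
    (hP m).comp_measurePreserving (measurePreserving_eval (fun _ : Fin n => P) t)
  exact h1.comp_fst _

namespace CodingScheme

variable {k R N n : ℕ}

/-- The encoding functions are almost everywhere limits of continuous encoding functions. -/
theorem exists_continuous_seq (C : CodingScheme k R n) (L : NodeLayout k R N)
    (H : Matrix (Fin N) (Fin N) ℝ)
    (ρ : Measure ((Fin n → Fin k → ℝ) × (Fin n → Fin N → ℝ))) [IsProbabilityMeasure ρ] :
    ∃ D : ℕ → CodingScheme k R n, (∀ l t, (D l).ContinuousAtTime t) ∧
      ∀ᵐ ω ∂ρ, ∀ t i, Filter.Tendsto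
        (fun l => (D l).transmit L ω.1 t i (C.past L H ω.1 ω.2 t i)) Filter.atTop
        (nhds (C.transmit L ω.1 t i (C.past L H ω.1 ω.2 t i))) := by
  have hsm : ∀ (m : Fin k) (t : Fin n),
      Measurable fun ω : (Fin n → Fin k → ℝ) × (Fin n → Fin N → ℝ) =>
        (((fun τ => ω.1 τ m), C.past L H ω.1 ω.2 t (L.src m)) :
          (Fin n → ℝ) × (Fin (t : ℕ) → ℝ)) := fun m t =>
    Measurable.prodMk (by fun_prop) (C.measurable_past L H t (L.src m))
  choose fs hfs hfs' using fun (m : Fin k) (t : Fin n) => exists_continuous_seq_tendsto_ae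
    (ρ.map fun ω => (((fun τ => ω.1 τ m), C.past L H ω.1 ω.2 t (L.src m)) :
          (Fin n → ℝ) × (Fin (t : ℕ) → ℝ))) (C.measurable_srcEnc m t)
  choose fr hfr hfr' using fun (p : Fin R) (t : Fin n) => exists_continuous_seq_tendsto_ae
    (ρ.map fun ω => C.past L H ω.1 ω.2 t (L.relay p)) (C.measurable_relayEnc p t)
  choose fd hfd hfd' using fun (m : Fin k) (t : Fin n) => exists_continuous_seq_tendsto_ae
    (ρ.map fun ω => C.past L H ω.1 ω.2 t (L.dst m)) (C.measurable_dstEnc m t)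
  let D : ℕ → CodingScheme k R n := fun l =>
    { srcEnc := fun m t x y => fs m t l (x, y)
      relayEnc := fun p t => fr p t l
      dstEnc := fun m t => fd m t l
      dec := C.dec
      measurable_srcEnc := fun m t => (hfs m t l).measurable
      measurable_relayEnc := fun p t => (hfr p t l).measurable
      measurable_dstEnc := fun m t => (hfd m t l).measurable
      measurable_dec := C.measurable_dec }
  refine ⟨D, fun l t => ⟨fun m => hfs m t l, fun p => hfr p t l, fun m => hfd m t l⟩, ?_⟩
  rw [ae_all_iff]; intro t
  rw [ae_all_iff]; intro i
  obtain ⟨a, rfl⟩ := L.node.surjective i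
  rcases a with m | m | p
  · filter_upwards [ae_of_ae_map (hsm m t).aemeasurable (hfs' m t)] with ω hω
    simpa [transmit, D, NodeLayout.src] using hω
  · filter_upwards [ae_of_ae_map (C.measurable_past L H t _).aemeasurable (hfd' m t)] with ω hω
    simpa [transmit, D, NodeLayout.dst] using hω
  · filter_upwards [ae_of_ae_map (C.measurable_past L H t _).aemeasurable (hfr' p t)] with ω hω
    simpa [transmit, D, NodeLayout.relay] using hω

/-- The decoding functions can be replaced by bounded continuous ones at a small cost. -/
theorem exists_boundedContinuousDec (C : CodingScheme k R n) (L : NodeLayout k R N)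
    (H : Matrix (Fin N) (Fin N) ℝ) (P : Measure (Fin k → ℝ)) [IsProbabilityMeasure P]
    (hP : ∀ m, MemLp (fun x : Fin k → ℝ => x m) 2 P)
    (γ : Measure (Fin N → ℝ)) [IsProbabilityMeasure γ]
    (hC : ∀ m, Integrable (C.blockDistortion quadraticDistortion L H m) (blockLaw P γ n))
    {ε : ℝ} (hε : 0 < ε) :
    ∃ (A : CodingScheme k R n) (M : ℝ), A.HasBoundedContinuousDec M ∧ A.AgreeBefore C n ∧
      ∀ m, ∫ ω, A.blockDistortion quadraticDistortion L H m ω ∂(blockLaw P γ n)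
        ≤ ∫ ω, C.blockDistortion quadraticDistortion L H m ω ∂(blockLaw P γ n) + ε := by
  -- One share for each of the `n` symbols; `n + 1` covers `n = 0`.
  have hε' : 0 < ε / (n + 1) := by positivity
  have hint : ∀ m t, Integrable (fun ω : (Fin n → Fin k → ℝ) × (Fin n → Fin N → ℝ) =>
      (ω.1 t m - C.estimate L H ω.1 ω.2 m t) ^ 2) (blockLaw P γ n) := by
    intro m t
    refine (hC m).mono' (((by fun_prop : Measurable fun ω :
      (Fin n → Fin k → ℝ) × (Fin n → Fin N → ℝ) => ω.1 t m).sub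
        (C.measurable_estimate L H m t)).pow_const 2).aestronglyMeasurable
      (Filter.Eventually.of_forall fun ω => ?_)
    rw [Real.norm_of_nonneg (sq_nonneg _)]
    exact Finset.single_le_sum
      (f := fun t => quadraticDistortion (ω.1 t m) (C.estimate L H ω.1 ω.2 m t))
      (fun _ _ => sq_nonneg _) (Finset.mem_univ t)
  choose h hh using fun (m : Fin k) (t : Fin n) => exists_boundedContinuous_integral_sq_le
    (blockLaw P γ n) (memLp_source_blockLaw P hP γ t m) (C.measurable_dstReceived L H (L.dst m))
    ((measurable_pi_apply t).comp (C.measurable_dec m)) (hint m t) hε'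
  let A : CodingScheme k R n :=
    { C with
      dec := fun m y t => h m t y
      measurable_dec := fun m => measurable_pi_lambda _ fun t => (h m t).continuous.measurable }
  have hagree : A.AgreeBefore C n := ⟨fun _ _ _ => rfl, fun _ _ _ => rfl, fun _ _ _ => rfl⟩
  refine ⟨A, ∑ m, ∑ t, ‖h m t‖, ⟨fun m => continuous_pi fun t => (h m t).continuous,
    fun m y t => ?_⟩, hagree, fun m => ?_⟩
  · refine ((h m t).norm_coe_le_norm y).trans ?_
    refine (Finset.single_le_sum (f := fun t => ‖h m t‖) (fun _ _ => norm_nonneg _)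
      (Finset.mem_univ t)).trans ?_
    exact Finset.single_le_sum (f := fun m => ∑ t, ‖h m t‖)
      (fun _ _ => Finset.sum_nonneg fun _ _ => norm_nonneg _) (Finset.mem_univ m)
  · have hest : ∀ x z t, A.estimate L H x z m t
        = h m t (fun s => C.received L H x z s (L.dst m)) := by
      intro x z t
      have : (fun s => A.received L H x z s (L.dst m))
          = fun s => C.received L H x z s (L.dst m) :=
        funext fun s => hagree.received L H x z s.isLt _
      simp only [estimate, this, A]
    have hint' : ∀ t, Integrable (fun ω : (Fin n → Fin k → ℝ) × (Fin n → Fin N → ℝ) =>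
        (ω.1 t m - h m t (fun s => C.received L H ω.1 ω.2 s (L.dst m))) ^ 2)
        (blockLaw P γ n) := fun t =>
      ((memLp_source_blockLaw P hP γ t m).sub
        (MemLp.of_bound ((h m t).continuous.measurable.comp
          (C.measurable_dstReceived L H (L.dst m))).aestronglyMeasurable ‖h m t‖
          (Filter.Eventually.of_forall fun ω => (h m t).norm_coe_le_norm _))).integrable_sq
    simp only [blockDistortion, quadraticDistortion, hest]
    rw [integral_finsetSum _ fun t _ => hint' t, integral_finsetSum _ fun t _ => hint m t]
    calc _ ≤ ∑ t : Fin n, (∫ ω, (ω.1 t m - C.estimate L H ω.1 ω.2 m t) ^ 2 ∂(blockLaw P γ n)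
          + ε / (n + 1)) := Finset.sum_le_sum fun t _ => hh m t
      _ ≤ _ := by
        rw [Finset.sum_add_distrib]
        gcongr
        simp only [Finset.sum_const, Finset.card_univ, Fintype.card_fin, nsmul_eq_mul]
        rw [mul_div_assoc', div_le_iff₀ (by positivity)]
        nlinarith

open Filter Topology in
/-- The encoding functions of one time can be made continuous at a small cost, if those of all
later times are continuous. -/
theorem exists_continuousAtTime_step (C A : CodingScheme k R n) {T : ℕ} {M : ℝ}
    (hM : A.HasBoundedContinuousDec M) (hAC : A.AgreeBefore C (T + 1))
    (hA : ∀ t : Fin n, T + 1 ≤ (t : ℕ) → A.ContinuousAtTime t) (L : NodeLayout k R N)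
    (H : Matrix (Fin N) (Fin N) ℝ) (P : Measure (Fin k → ℝ)) [IsProbabilityMeasure P]
    (hP : ∀ m, MemLp (fun x : Fin k → ℝ => x m) 2 P)
    (γ : Measure (Fin N → ℝ)) [IsProbabilityMeasure γ] {ε : ℝ} (hε : 0 < ε) :
    ∃ A' : CodingScheme k R n, A'.HasBoundedContinuousDec M ∧ A'.AgreeBefore C T ∧
      (∀ t : Fin n, T ≤ (t : ℕ) → A'.ContinuousAtTime t) ∧
      ∀ m, ∫ ω, A'.blockDistortion quadraticDistortion L H m ω ∂(blockLaw P γ n)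
        ≤ ∫ ω, A.blockDistortion quadraticDistortion L H m ω ∂(blockLaw P γ n) + ε := by
  -- Approximants along the pasts of `C` serve for `A`, since the two schemes agree up to time `T`
  -- inclusive.
  obtain ⟨D, hD, hlim⟩ := C.exists_continuous_seq L H (blockLaw P γ n)
  have hM' : ∀ l, (A.replaceAt (D l) T).HasBoundedContinuousDec M := fun l => ⟨hM.cont, hM.bound⟩
  have hconv : ∀ m, Tendsto (fun l => ∫ ω, (A.replaceAt (D l) T).blockDistortion
      quadraticDistortion L H m ω ∂(blockLaw P γ n)) atTop
      (𝓝 (∫ ω, A.blockDistortion quadraticDistortion L H m ω ∂(blockLaw P γ n))) := by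
    intro m
    refine tendsto_integral_of_dominated_convergence (fun ω => distortionBound M m ω.1)
      (fun l => (measurable_blockDistortion _ L H m).aestronglyMeasurable)
      ((integrable_distortionBound P hP M m).comp_fst _)
      (fun l => Eventually.of_forall fun ω => ?_) ?_
    · rw [Real.norm_of_nonneg (blockDistortion_nonneg _ L H m ω)]
      exact blockDistortion_le (hM' l) L H m ω
    · filter_upwards [hlim] with ω hω
      have hrec := tendsto_received_replaceAt A D hA L H ω.1 ω.2 (fun t ht i => by
        rw [hAC.past L H ω.1 ω.2 (by omega), hAC.transmit L ω.1 (by omega)]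
        exact hω t i)
      unfold blockDistortion quadraticDistortion estimate
      refine tendsto_finsetSum _ fun t _ => (tendsto_const_nhds.sub ?_).pow 2
      exact (((continuous_apply t).comp (hM.cont m)).tendsto _).comp
        (tendsto_pi_nhds.2 fun s => hrec s (L.dst m))
  have hev : ∀ᶠ l in atTop, ∀ m, ∫ ω, (A.replaceAt (D l) T).blockDistortion
      quadraticDistortion L H m ω ∂(blockLaw P γ n)
      ≤ ∫ ω, A.blockDistortion quadraticDistortion L H m ω ∂(blockLaw P γ n) + ε :=
    eventually_all.2 fun m => (hconv m).eventually_le_const (by linarith)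
  obtain ⟨l, hl⟩ := hev.exists
  exact ⟨A.replaceAt (D l) T, hM' l,
    (replaceAt_agreeBefore A (D l) T).trans (hAC.mono T.le_succ),
    replaceAt_continuousAtTime (hD l) hA, hl⟩

/-- A scheme can be replaced, at a small cost, by one with continuous encoding functions and
bounded continuous decoding functions. -/
theorem exists_continuous_scheme (C : CodingScheme k R n) (L : NodeLayout k R N)
    (H : Matrix (Fin N) (Fin N) ℝ) (P : Measure (Fin k → ℝ)) [IsProbabilityMeasure P]
    (hP : ∀ m, MemLp (fun x : Fin k → ℝ => x m) 2 P)
    (γ : Measure (Fin N → ℝ)) [IsProbabilityMeasure γ]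
    (hC : ∀ m, Integrable (C.blockDistortion quadraticDistortion L H m) (blockLaw P γ n))
    {ε : ℝ} (hε : 0 < ε) :
    ∃ (A : CodingScheme k R n) (M : ℝ), A.HasBoundedContinuousDec M ∧
      (∀ t, A.ContinuousAtTime t) ∧
      ∀ m, ∫ ω, A.blockDistortion quadraticDistortion L H m ω ∂(blockLaw P γ n)
        ≤ ∫ ω, C.blockDistortion quadraticDistortion L H m ω ∂(blockLaw P γ n) + ε := by
  obtain ⟨A₀, M, hM, hAC, hA₀⟩ := C.exists_boundedContinuousDec L H P hP γ hC (half_pos hε)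
  -- Backward induction in time: `s` counts the final times already made continuous. The budget `δ`
  -- is quantified so that each step can halve it.
  have key : ∀ s ≤ n, ∀ δ : ℝ, 0 < δ → ∃ A : CodingScheme k R n, A.HasBoundedContinuousDec M ∧
      A.AgreeBefore C (n - s) ∧ (∀ t : Fin n, n - s ≤ (t : ℕ) → A.ContinuousAtTime t) ∧
      ∀ m, ∫ ω, A.blockDistortion quadraticDistortion L H m ω ∂(blockLaw P γ n)
        ≤ ∫ ω, A₀.blockDistortion quadraticDistortion L H m ω ∂(blockLaw P γ n) + δ := by
    intro s
    induction s with
    | zero =>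
      intro _ δ hδ
      exact ⟨A₀, hM, hAC, fun t ht => absurd t.isLt (by omega), fun m => by linarith⟩
    | succ s ih =>
      intro hs δ hδ
      obtain ⟨A, hAM, hAC', hAc, hAd⟩ := ih (by omega) (δ / 2) (half_pos hδ)
      have hT : n - s = (n - (s + 1)) + 1 := by omega
      rw [hT] at hAC' hAc
      obtain ⟨A', h1, h2, h3, h4⟩ :=
        exists_continuousAtTime_step C A hAM hAC' hAc L H P hP γ (half_pos hδ)
      exact ⟨A', h1, h2, h3, fun m => by linarith [h4 m, hAd m]⟩
  obtain ⟨A, h1, -, h3, h4⟩ := key n le_rfl (ε / 2) (half_pos hε)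
  exact ⟨A, M, h1, fun t => h3 t (by omega), fun m => by linarith [h4 m, hA₀ m]⟩

end CodingScheme

/-! ### Interleaved copies mixed by an orthogonal matrix -/

/-- Causality of interleaving: when block `t.divNat` is being sent, every slot of an earlier block
has been received and can be demixed. -/
theorem finProdFinEquiv_lt_of_fst_lt {n B : ℕ} {τ : ℕ} (b : Fin B) {t : Fin (n * B)}
    (h : τ < (t.divNat : ℕ)) : (b : ℕ) + B * τ < (t : ℕ) := by
  have h1 : τ + 1 ≤ (t : ℕ) / B := h
  have hB : 0 < B := b.pos
  have h2 : (τ + 1) * B ≤ (t : ℕ) := (Nat.le_div_iff_mul_le hB).1 h1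
  have := b.isLt
  nlinarith

namespace CodingScheme

variable {k R N n B : ℕ}

/-- The signal `∑ b, q b * y[τ B + b] + o` recovered from the signals before time `t`. -/
noncomputable def demixPast (q : Fin B → ℝ) (o : ℝ) (t : Fin (n * B)) (y : Fin (t : ℕ) → ℝ) :
    Fin (t.divNat : ℕ) → ℝ :=
  fun τ => ∑ b : Fin B, q b * y ⟨b + B * τ, finProdFinEquiv_lt_of_fst_lt b τ.isLt⟩ + o

/-- The signal `∑ b, q b * y[τ B + b] + o` recovered from the signals of a whole block. -/
noncomputable def demix (q : Fin B → ℝ) (o : ℝ) (y : Fin (n * B) → ℝ) : Fin n → ℝ :=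
  fun τ => ∑ b : Fin B, q b * y (finProdFinEquiv (τ, b)) + o

theorem measurable_demixPast (q : Fin B → ℝ) (o : ℝ) (t : Fin (n * B)) :
    Measurable (demixPast q o t) := by
  unfold demixPast
  fun_prop

theorem measurable_demix (q : Fin B → ℝ) (o : ℝ) :
    Measurable (demix (n := n) q o) := by
  unfold demix
  fun_prop

/-- `B` interleaved copies of a scheme. The symbols which the copies send at time `t` are mixed by
the matrix `Q` and sent at the times `t B + b`; a node undoes the mixing for what it receives and
adds the offsets `o`. -/
noncomputable def interleave (C : CodingScheme k R n) (L : NodeLayout k R N)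
    (Q : Matrix (Fin B) (Fin B) ℝ) (o : Fin B → Fin N → ℝ) : CodingScheme k R (n * B) where
  srcEnc m t x y := ∑ j, Q j t.modNat *
    C.srcEnc m t.divNat (fun τ => x (finProdFinEquiv (τ, j))) (demixPast (Q j) (o j (L.src m)) t y)
  relayEnc p t y := ∑ j, Q j t.modNat *
    C.relayEnc p t.divNat (demixPast (Q j) (o j (L.relay p)) t y)
  dstEnc m t y := ∑ j, Q j t.modNat *
    C.dstEnc m t.divNat (demixPast (Q j) (o j (L.dst m)) t y)
  dec m y := fun t => C.dec m (demix (Q t.modNat) (o t.modNat (L.dst m)) y) t.divNat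
  measurable_srcEnc m t := Finset.measurable_sum _ fun j _ => Measurable.const_mul
    ((C.measurable_srcEnc m t.divNat).comp (Measurable.prodMk (by fun_prop)
      ((measurable_demixPast _ _ t).comp measurable_snd))) _
  measurable_relayEnc p t := Finset.measurable_sum _ fun j _ => Measurable.const_mul
    ((C.measurable_relayEnc p t.divNat).comp (measurable_demixPast _ _ t)) _
  measurable_dstEnc m t := Finset.measurable_sum _ fun j _ => Measurable.const_mul
    ((C.measurable_dstEnc m t.divNat).comp (measurable_demixPast _ _ t)) _
  measurable_dec m := measurable_pi_lambda _ fun t => (measurable_pi_apply _).comp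
    ((C.measurable_dec m).comp (measurable_demix _ _))

theorem interleave_transmit (C : CodingScheme k R n) (L : NodeLayout k R N)
    (Q : Matrix (Fin B) (Fin B) ℝ) (o : Fin B → Fin N → ℝ) (x : Fin (n * B) → Fin k → ℝ)
    (t : Fin (n * B)) (i : Fin N) (y : Fin (t : ℕ) → ℝ) :
    (C.interleave L Q o).transmit L x t i y = ∑ j, Q j t.modNat *
      C.transmit L (fun τ => x (finProdFinEquiv (τ, j))) t.divNat i
        (demixPast (Q j) (o j i) t y) := by
  obtain ⟨a, rfl⟩ := L.node.surjective i
  rcases a with m | m | p <;>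
    simp [transmit, interleave, NodeLayout.src, NodeLayout.dst, NodeLayout.relay]

/-- The type of the past depends on the time, and the block index of slot `(t, b)` is rewritten to
`t` only through a proved equality. -/
theorem transmit_congr_time (C : CodingScheme k R n) (L : NodeLayout k R N)
    (x : Fin n → Fin k → ℝ) {s t : Fin n} (h : s = t) (i : Fin N) (y : Fin (s : ℕ) → ℝ)
    (y' : Fin (t : ℕ) → ℝ) (hy : ∀ τ (h1 : τ < (s : ℕ)) (h2 : τ < (t : ℕ)), y ⟨τ, h1⟩ = y' ⟨τ, h2⟩) :
    C.transmit L x s i y = C.transmit L x t i y' := by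
  subst h
  congr 1
  funext τ
  exact hy τ τ.isLt τ.isLt

/-- Each copy of an interleaved scheme receives what the original scheme receives, for demixed
noise. -/
theorem demix_received_interleave (C : CodingScheme k R n) (L : NodeLayout k R N)
    (H : Matrix (Fin N) (Fin N) ℝ) {Q : Matrix (Fin B) (Fin B) ℝ} (hQ : Q * Q.transpose = 1)
    (o : Fin B → Fin N → ℝ) (x : Fin (n * B) → Fin k → ℝ) (z : Fin (n * B) → Fin N → ℝ)
    (j : Fin B) (i : Fin N) (t : Fin n) :
    demix (Q j) (o j i) (fun s => (C.interleave L Q o).received L H x z s i) t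
      = C.received L H (fun τ => x (finProdFinEquiv (τ, j)))
          (fun τ => weightedSum (Q j) (o j) fun b => z (finProdFinEquiv (τ, b))) t i := by
  obtain ⟨t, ht⟩ := t
  induction t using Nat.strong_induction_on generalizing i j with
  | _ t ih =>
    set t' : Fin n := ⟨t, ht⟩ with ht'
    have hdiv : ∀ b : Fin B, (finProdFinEquiv (t', b)).divNat = t' := fun b =>
      congrArg Prod.fst (finProdFinEquiv.symm_apply_apply (t', b))
    have hmod : ∀ b : Fin B, (finProdFinEquiv (t', b)).modNat = b := fun b =>
      congrArg Prod.snd (finProdFinEquiv.symm_apply_apply (t', b))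
    have htr : ∀ (b : Fin B) (l : Fin N), (C.interleave L Q o).transmit L x
        (finProdFinEquiv (t', b)) l
        ((C.interleave L Q o).past L H x z (finProdFinEquiv (t', b)) l)
        = ∑ j', Q j' b * C.transmit L (fun τ => x (finProdFinEquiv (τ, j'))) t' l
          (C.past L H (fun τ => x (finProdFinEquiv (τ, j')))
            (fun τ => weightedSum (Q j') (o j') fun b => z (finProdFinEquiv (τ, b))) t' l) := by
      intro b l
      rw [interleave_transmit]
      refine Finset.sum_congr rfl fun j' _ => ?_
      rw [hmod]
      congr 1
      refine C.transmit_congr_time L _ (hdiv b) l _ _ fun τ h1 h2 => ?_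
      -- A slot carries symbols of all copies from all nodes, hence the induction over every `j` and
      -- `i` at once.
      exact ih τ h2 j' l (lt_trans h2 ht)
    -- Orthonormal rows: demixing by row `j` removes the other copies' symbols and keeps its own
    -- with coefficient 1.
    have horth : ∀ j', ∑ b, Q j b * Q j' b = if j = j' then 1 else 0 := by
      intro j'
      have := congrFun (congrFun hQ j) j'
      rw [Matrix.mul_apply] at this
      simpa [Matrix.one_apply] using this
    rw [received_eq C]
    unfold demix
    simp only [received_eq (C.interleave L Q o), htr]
    simp only [mul_add, Finset.sum_add_distrib, weightedSum]
    rw [add_assoc]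
    congr 1
    simp only [Finset.mul_sum]
    rw [Finset.sum_comm]
    refine Finset.sum_congr rfl fun l _ => ?_
    rw [Finset.sum_comm]
    have hstep : ∀ j', ∑ b, Q j b * (H i l * (Q j' b *
        C.transmit L (fun τ => x (finProdFinEquiv (τ, j'))) t' l
          (C.past L H (fun τ => x (finProdFinEquiv (τ, j')))
            (fun τ => weightedSum (Q j') (o j') fun b => z (finProdFinEquiv (τ, b))) t' l)))
        = (∑ b, Q j b * Q j' b) * (H i l *
        C.transmit L (fun τ => x (finProdFinEquiv (τ, j'))) t' l
          (C.past L H (fun τ => x (finProdFinEquiv (τ, j')))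
            (fun τ => weightedSum (Q j') (o j') fun b => z (finProdFinEquiv (τ, b))) t' l)) := by
      intro j'
      rw [Finset.sum_mul]
      exact Finset.sum_congr rfl fun b _ => by ring
    rw [Finset.sum_congr rfl fun j' _ => hstep j']
    simp only [horth, ite_mul, one_mul, zero_mul, Finset.sum_ite_eq, Finset.mem_univ, if_true]

theorem interleave_estimate (C : CodingScheme k R n) (L : NodeLayout k R N)
    (H : Matrix (Fin N) (Fin N) ℝ) {Q : Matrix (Fin B) (Fin B) ℝ} (hQ : Q * Q.transpose = 1)
    (o : Fin B → Fin N → ℝ) (x : Fin (n * B) → Fin k → ℝ) (z : Fin (n * B) → Fin N → ℝ)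
    (m : Fin k) (t : Fin n) (j : Fin B) :
    (C.interleave L Q o).estimate L H x z m (finProdFinEquiv (t, j))
      = C.estimate L H (fun τ => x (finProdFinEquiv (τ, j)))
          (fun τ => weightedSum (Q j) (o j) fun b => z (finProdFinEquiv (τ, b))) m t := by
  have hdiv : (finProdFinEquiv (t, j)).divNat = t :=
    congrArg Prod.fst (finProdFinEquiv.symm_apply_apply (t, j))
  have hmod : (finProdFinEquiv (t, j)).modNat = j :=
    congrArg Prod.snd (finProdFinEquiv.symm_apply_apply (t, j))
  have h := funext (C.demix_received_interleave L H hQ o x z j (L.dst m))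
  unfold estimate
  rw [← h]
  change C.dec m (demix (Q (finProdFinEquiv (t, j)).modNat)
    (o (finProdFinEquiv (t, j)).modNat (L.dst m)) _) (finProdFinEquiv (t, j)).divNat = _
  rw [hdiv, hmod]

/-- The data seen by one copy of an interleaved scheme. -/
noncomputable def copyData (q : Fin B → ℝ) (o : Fin N → ℝ) (j : Fin B)
    (ω : (Fin (n * B) → Fin k → ℝ) × (Fin (n * B) → Fin N → ℝ)) :
    (Fin n → Fin k → ℝ) × (Fin n → Fin N → ℝ) :=
  (fun τ => ω.1 (finProdFinEquiv (τ, j)),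
    fun τ => weightedSum q o fun b => ω.2 (finProdFinEquiv (τ, b)))

/-- Additivity over the copies makes their joint law irrelevant: expectations need only the law of
each `copyData`. -/
theorem interleave_blockDistortion (C : CodingScheme k R n) (L : NodeLayout k R N)
    (H : Matrix (Fin N) (Fin N) ℝ) {Q : Matrix (Fin B) (Fin B) ℝ} (hQ : Q * Q.transpose = 1)
    (o : Fin B → Fin N → ℝ) (φ : ℝ → ℝ → ℝ) (m : Fin k)
    (ω : (Fin (n * B) → Fin k → ℝ) × (Fin (n * B) → Fin N → ℝ)) :
    (C.interleave L Q o).blockDistortion φ L H m ω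
      = ∑ j, C.blockDistortion φ L H m (copyData (Q j) (o j) j ω) := by
  unfold blockDistortion
  rw [← finProdFinEquiv.sum_comp, Fintype.sum_prod_type_right]
  simp only [C.interleave_estimate L H hQ, copyData]

/-- The law of the data seen by one copy of an interleaved scheme. -/
theorem measurePreserving_copyData (P : Measure (Fin k → ℝ)) [IsProbabilityMeasure P]
    (μ : Measure (Fin N → ℝ)) [IsProbabilityMeasure μ] (q : Fin B → ℝ) (c : Fin N → ℝ)
    (j : Fin B) :
    MeasurePreserving (copyData (k := k) (n := n) q (meanOffset q (meanVector μ) c) j)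
      (blockLaw P μ (n * B)) (blockLaw P (weightedSumLaw μ q c : Measure (Fin N → ℝ)) n) := by
  have h1 : MeasurePreserving (fun (x : Fin (n * B) → Fin k → ℝ) (τ : Fin n) =>
      x (finProdFinEquiv (τ, j))) (Measure.pi fun _ => P) (Measure.pi fun _ => P) := by
    refine ⟨by fun_prop, pi_map_comp_injective P _ fun a b hab => ?_⟩
    have := finProdFinEquiv.injective hab
    exact congrArg Prod.fst this
  have h2 : MeasurePreserving (fun (z : Fin (n * B) → Fin N → ℝ) (p : Fin n × Fin B) =>
      z (finProdFinEquiv p)) (Measure.pi fun _ => μ) (Measure.pi fun _ => μ) :=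
    ⟨by fun_prop, pi_map_comp_injective μ _ finProdFinEquiv.injective⟩
  have h3 : MeasurePreserving (fun (z : Fin n × Fin B → Fin N → ℝ) (τ : Fin n) (b : Fin B) =>
      z (τ, b)) (Measure.pi fun _ => μ) (Measure.pi fun _ => Measure.pi fun _ => μ) :=
    ⟨by fun_prop, pi_map_curry μ⟩
  have hw : MeasurePreserving (weightedSum q (meanOffset q (meanVector μ) c))
      (Measure.pi fun _ : Fin B => μ) (weightedSumLaw μ q c : Measure (Fin N → ℝ)) :=
    ⟨measurable_weightedSum _ _, rfl⟩
  have h4 := measurePreserving_pi (fun _ : Fin n => Measure.pi fun _ : Fin B => μ)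
    (fun _ => (weightedSumLaw μ q c : Measure (Fin N → ℝ))) (fun _ => hw)
  exact h1.prod (h4.comp (h3.comp h2))

/-! ### Dependence of the distortion on the noise law -/

open Filter Topology in
/-- The expected distortion of a continuous scheme depends continuously on the noise law. -/
theorem tendsto_integral_blockDistortion {A : CodingScheme k R n} {M : ℝ}
    (hM : A.HasBoundedContinuousDec M) (hA : ∀ t, A.ContinuousAtTime t) (L : NodeLayout k R N)
    (H : Matrix (Fin N) (Fin N) ℝ) (P : Measure (Fin k → ℝ)) [IsProbabilityMeasure P]
    (hP : ∀ m, MemLp (fun x : Fin k → ℝ => x m) 2 P)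
    {ν : ℕ → ProbabilityMeasure (Fin N → ℝ)} {ν₀ : ProbabilityMeasure (Fin N → ℝ)}
    (hν : Tendsto ν atTop (𝓝 ν₀)) (m : Fin k) :
    Tendsto (fun r => ∫ ω, A.blockDistortion quadraticDistortion L H m ω
        ∂(blockLaw P (ν r : Measure (Fin N → ℝ)) n)) atTop
      (𝓝 (∫ ω, A.blockDistortion quadraticDistortion L H m ω
        ∂(blockLaw P (ν₀ : Measure (Fin N → ℝ)) n))) := by
  have hpi : Tendsto (fun r => ProbabilityMeasure.pi fun _ : Fin n => ν r) atTop
      (𝓝 (ProbabilityMeasure.pi fun _ : Fin n => ν₀)) :=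
    (ProbabilityMeasure.continuous_pi.tendsto fun _ : Fin n => ν₀).comp
      (tendsto_pi_nhds.2 fun _ => hν)
  -- Integrating over the noise first, at a fixed source block, leaves an integrand bounded and
  -- continuous in the noise; the source law stays arbitrary.
  have hfub : ∀ σ : ProbabilityMeasure (Fin N → ℝ),
      ∫ ω, A.blockDistortion quadraticDistortion L H m ω
        ∂(blockLaw P (σ : Measure (Fin N → ℝ)) n)
      = ∫ x, ∫ z, A.blockDistortion quadraticDistortion L H m (x, z)
        ∂((ProbabilityMeasure.pi fun _ : Fin n => σ : ProbabilityMeasure (Fin n → Fin N → ℝ)) :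
          Measure (Fin n → Fin N → ℝ)) ∂(Measure.pi fun _ : Fin n => P) := fun σ =>
    integral_prod _ (integrable_blockDistortion hM L H P hP
      (Measure.pi fun _ : Fin n => (σ : Measure (Fin N → ℝ))) m)
  simp only [hfub]
  refine tendsto_integral_of_dominated_convergence (distortionBound M m)
    (fun r => ?_) (integrable_distortionBound P hP M m)
    (fun r => Eventually.of_forall fun x => ?_) (Eventually.of_forall fun x => ?_)
  · exact (integrable_blockDistortion hM L H P hP
      (Measure.pi fun _ : Fin n => (ν r : Measure (Fin N → ℝ))) m).integral_prod_left.1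
  · have := norm_integral_le_of_norm_le_const (C := distortionBound M m x)
      (μ := ((ProbabilityMeasure.pi fun _ : Fin n => ν r) : Measure (Fin n → Fin N → ℝ)))
      (f := fun z => A.blockDistortion quadraticDistortion L H m (x, z))
      (Eventually.of_forall fun z => by
        rw [Real.norm_of_nonneg (A.blockDistortion_nonneg L H m (x, z))]
        exact blockDistortion_le hM L H m (x, z))
    simpa using this
  · let F : BoundedContinuousFunction (Fin n → Fin N → ℝ) ℝ :=
      BoundedContinuousFunction.ofNormedAddCommGroup
        (fun z => A.blockDistortion quadraticDistortion L H m (x, z))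
        (continuous_blockDistortion hA hM L H m x) (distortionBound M m x) fun z => by
          rw [Real.norm_of_nonneg (A.blockDistortion_nonneg L H m (x, z))]
          exact blockDistortion_le hM L H m (x, z)
    exact ProbabilityMeasure.tendsto_iff_forall_integral_tendsto.1 hpi F

end CodingScheme

/-! ### Transfer of achievability and the theorem -/

open Filter Topology in
theorem IsAchievable.add_of_hasCovarianceMatrix {k R N : ℕ} {L : NodeLayout k R N}
    {H : Matrix (Fin N) (Fin N) ℝ} {P : Measure (Fin k → ℝ)} [IsProbabilityMeasure P]
    (hP : ∀ m, MemLp (fun x : Fin k → ℝ => x m) 2 P) {K : Matrix (Fin N) (Fin N) ℝ}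
    {γ : Measure (Fin N → ℝ)} [IsGaussian γ] (hγ : HasCovarianceMatrix γ K)
    {μ : Measure (Fin N → ℝ)} [IsProbabilityMeasure μ] (hμ : HasCovarianceMatrix μ K)
    {D : Fin k → ℝ} (hD : IsAchievable quadraticDistortion L H P γ D) {ε : ℝ} (hε : 0 < ε) :
    IsAchievable quadraticDistortion L H P μ (fun m => D m + ε) := by
  obtain ⟨n, hn, C, hC⟩ := hD
  have hn' : (0 : ℝ) < n := by exact_mod_cast hn
  -- Half of the slack pays for continuity; the rest makes `hAγ` strict, so that it survives the
  -- limit in the noise law.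
  have hnε : 0 < n * ε / 2 := by positivity
  obtain ⟨A, M, hM, hA, hAd⟩ :=
    C.exists_continuous_scheme L H P hP γ (fun m => (hC m).1) hnε
  have hAγ : ∀ m, ∫ ω, A.blockDistortion quadraticDistortion L H m ω ∂(blockLaw P γ n)
      < n * (D m + ε) := by
    intro m
    have h1 := (hC m).2
    rw [one_div, inv_mul_le_iff₀ hn'] at h1
    have h2 := hAd m
    nlinarith
  choose Q hQ hQQ using exists_flat_orthogonal
  have hB : Tendsto (fun r : ℕ => 2 ^ r) atTop atTop :=
    tendsto_pow_atTop_atTop_of_one_lt (by norm_num)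
  -- One `r` must serve all rows, whose number grows with `r`. Otherwise a bad row exists for every
  -- `r`; the central limit theorem allows any signs, so it applies to this sequence of rows and
  -- gives a contradiction.
  obtain ⟨r, hr⟩ : ∃ r : ℕ, ∀ (j : Fin (2 ^ r)) (m : Fin k),
      ∫ ω, A.blockDistortion quadraticDistortion L H m ω
        ∂(blockLaw P (weightedSumLaw μ (Q r j) (meanVector γ) : Measure (Fin N → ℝ)) n)
      ≤ n * (D m + ε) := by
    by_contra! hcon
    choose j m hjm using hcon
    have hlim := tendsto_weightedSumLaw K γ hγ μ hμ hB (fun r => Q r (j r))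
      (fun r b => hQ r (j r) b)
    have hev : ∀ᶠ r in atTop, ∀ m, ∫ ω, A.blockDistortion quadraticDistortion L H m ω
        ∂(blockLaw P (weightedSumLaw μ (Q r (j r)) (meanVector γ) : Measure (Fin N → ℝ)) n)
        ≤ n * (D m + ε) :=
      eventually_all.2 fun m => (CodingScheme.tendsto_integral_blockDistortion hM hA L H P hP
        hlim m).eventually_le_const (hAγ m)
    obtain ⟨r, hr⟩ := hev.exists
    exact absurd (hr (m r)) (not_le.2 (hjm r))
  let o : Fin (2 ^ r) → Fin N → ℝ := fun j =>
    meanOffset (Q r j) (meanVector μ) (meanVector γ)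
  have hcopy : ∀ (m : Fin k) (j : Fin (2 ^ r)),
      Integrable (fun ω => A.blockDistortion quadraticDistortion L H m
        (CodingScheme.copyData (Q r j) (o j) j ω)) (blockLaw P μ (n * 2 ^ r)) := fun m j =>
    (CodingScheme.measurePreserving_copyData P μ (Q r j) (meanVector γ)
      j).integrable_comp_of_integrable
        (CodingScheme.integrable_blockDistortion hM L H P hP _ m)
  refine ⟨n * 2 ^ r, by positivity, A.interleave L (Q r) o, fun m => ?_⟩
  have heq : (A.interleave L (Q r) o).blockDistortion quadraticDistortion L H m
      = fun ω => ∑ j, A.blockDistortion quadraticDistortion L H m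
        (CodingScheme.copyData (Q r j) (o j) j ω) :=
    funext fun ω => A.interleave_blockDistortion L H (hQQ r) o quadraticDistortion m ω
  rw [heq]
  refine ⟨integrable_finsetSum _ fun j _ => hcopy m j, ?_⟩
  rw [integral_finsetSum _ fun j _ => hcopy m j, one_div,
    inv_mul_le_iff₀ (by positivity)]
  calc _ = ∑ j, ∫ ω, A.blockDistortion quadraticDistortion L H m ω
        ∂(blockLaw P (weightedSumLaw μ (Q r j) (meanVector γ) : Measure (Fin N → ℝ)) n) := by
        refine Finset.sum_congr rfl fun j _ => ?_
        have hmp := CodingScheme.measurePreserving_copyData (n := n) P μ (Q r j) (meanVector γ) j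
        rw [← hmp.map_eq, integral_map hmp.measurable.aemeasurable
          (A.measurable_blockDistortion L H m).aestronglyMeasurable]
    _ ≤ ∑ _j : Fin (2 ^ r), n * (D m + ε) := Finset.sum_le_sum fun j _ => hr j m
    _ = _ := by
        simp only [Finset.sum_const, Finset.card_univ, Fintype.card_fin, nsmul_eq_mul]
        push_cast
        ring

theorem theorem2 {k R N : ℕ} (L : NodeLayout k R N) (H : Matrix (Fin N) (Fin N) ℝ)
    (P : Measure (Fin k → ℝ)) [IsProbabilityMeasure P]
    (hP : ∀ m, MemLp (fun x : Fin k → ℝ => x m) 2 P)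
    (K : Matrix (Fin N) (Fin N) ℝ)
    (γ : Measure (Fin N → ℝ)) [IsGaussian γ] (hγ : HasCovarianceMatrix γ K)
    (μ : Measure (Fin N → ℝ)) [IsProbabilityMeasure μ] (hμ : HasCovarianceMatrix μ K) :
    distortionRegion quadraticDistortion L H P γ ⊆ distortionRegion quadraticDistortion L H P μ ∧
    ∀ D : Fin k → ℝ, IsAchievable quadraticDistortion L H P γ D →
      ∀ ε : ℝ, 0 < ε → IsAchievable quadraticDistortion L H P μ (fun m => D m + ε) := by
  refine ⟨closure_minimal (fun D hD => ?_) isClosed_closure,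
    fun D hD ε hε => hD.add_of_hasCovarianceMatrix hP hγ hμ hε⟩
  -- An achievable `D` is the limit of the tuples `D + 1 / (l + 1)`, achievable for `μ`.
  refine mem_closure_of_tendsto (b := Filter.atTop)
    (f := fun (l : ℕ) (m : Fin k) => D m + 1 / ((l : ℝ) + 1)) ?_
    (Filter.Eventually.of_forall fun l =>
      hD.add_of_hasCovarianceMatrix hP hγ hμ (by positivity))
  refine tendsto_pi_nhds.2 fun m => ?_
  simpa using (tendsto_one_div_add_atTop_nhds_zero_nat (𝕜 := ℝ)).const_add (D m)
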